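/- Let $\mathcal{H}=(\mathbb{C}^2)^{\otimes n}$. A stabilizer state is a unit vector $|s\rangle\in\mathcal H$ fixed by an Abelian group of $2^n$ Pauli operators not containing $-1$. A codeword-stabilized (CWS) code of length $n$ and dimension $K$ is a $K$-dimensional subspace $\mathcal{Q}=\mathrm{span}\{W_1|s\rangle,\dots,W_K|s\rangle\}\subseteq\mathcal H$, where $|s\rangle$ is a stabilizer state and $W_1,\dots,W_K$ are mutually commuting Pauli operators. An operator $E$ acts trivially on $\mathcal{Q}$ if $E|\psi\rangle=c|\psi\rangle$ for all $|\psi\rangle\in\mathcal{Q}$ with $c$ independent of $|\psi\rangle$; it is detectable if it acts trivially on $\mathcal{Q}$ or takes every nonzero $|\psi\rangle\in\mathcal{Q}$ to a state outside $\mathcal{Q}$. The code is $t$-error correcting if $E_1^\dagger E_2$ is detectable for all Pauli operators $E_1,E_2$ of weight at most $t$ (the weight being the number of nontrivial tensor factors); $E_1$ and $E_2$ are degenerate if $E_1^\dagger E_2$ acts trivially on $\mathcal Q$. For a group $\mathbb{G}$ of Pauli operators put $\mathbb{G}(\mathcal{Q})=\mathrm{span}\{E|\psi\rangle:E\in\mathbb{G},\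 |\psi\rangle\in\mathcal{Q}\}$, and for a set $A$ of qubits let $\mathbb{E}_A=\langle X_i,Z_i\rangle_{i\in A}$. A measurement is the two-outcome measurement of the orthogonal projector $P$ onto a subspace of $\mathcal H$. It requires at most $g$ two-qubit gates if some circuit of arbitrary one-qubit unitaries and at most $g$ arbitrary two-qubit unitaries on the $n$ qubits and finitely many ancillas takes $|\psi\rangle\otimes|0\cdots0\rangle$ to $P|\psi\rangle\otimes|1\rangle\otimes|0\cdots0\rangle+(1-P)|\psi\rangle\otimes|0\rangle\otimes|0\cdots0\rangle$ for all $|\psi\rangle\in\mathcal H$, the first ancilla being the one that is read out. Theorem. Let $t\le n$, and let $n\ge2$ unless $t=0$. Let $\mathcal{Q}$ be a $t$-error-correcting CWS code of length $n$ and dimension $K$. Then there is an adaptive procedure that uses at most $$N(n,t)=\binom{n}{t}+2t-1$$ measurements, each of which requires at most $2K(n-1)(n+3)$ two-qubit gates, and that corrects all Pauli errors of weight at most $t$ on $\mathcal{Q}$: for every sequence of outcomes it returns a Pauli operator $R$ such that applying $R^\dagger$ restores the encoded state, up to a factor independent of that state. Moreover, for every Pauli error $E$ of weight at most $t$, each sequence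 of outcomes either never occurs, or leaves the corrupted state $E|\psi\rangle$ undisturbed for all $|\psi\rangle\in\mathcal{Q}$ and returns an $R$ of weight at most $t$ that is degenerate with $E$. The procedure uses clustered measurements: for some enumeration $A_1,\dots,A_{\binom nt}$ of the sets of $t$ qubits, it measures the projectors onto $\mathbb{E}_{A_j}(\mathcal{Q})$ for $j=1,2,\dots,\binom nt-1$ in turn until the first positive outcome; then, with $A$ the set of that outcome (or the last set, if there was none), it runs at most $2t$ subgroup tests, each measuring the projector onto $\mathbb{G}(\mathcal{Q})$ for a subgroup $\mathbb{G}\le\mathbb{E}_A$, and returns an operator $R$ supported on $A$. -/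

import Mathlib

namespace CWS

noncomputable section

/-- State space of a register of qubits labelled by `ι`: the Hilbert space with orthonormal
basis the bit strings `ι → Fin 2`. -/
abbrev Qubits (ι : Type) [Fintype ι] := EuclideanSpace ℂ (ι → Fin 2)

/-- The space of `n`-qubit states. -/
abbrev H (n : ℕ) := Qubits (Fin n)

/-- Linear operators on `n` qubits, as matrices in the computational basis. -/
abbrev Op (n : ℕ) := Matrix (Fin n → Fin 2) (Fin n → Fin 2) ℂ

/-- The unitary group on `n` qubits. -/
abbrev U (n : ℕ) := Matrix.unitaryGroup (Fin n → Fin 2) ℂ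

/-- Action of an operator on states. -/
def act {n : ℕ} (M : Op n) : H n →ₗ[ℂ] H n := Matrix.toEuclideanLin M

/-! ### Pauli operators -/

inductive Letter where
  | I
  | X
  | Y
  | Z
  deriving DecidableEq

def Letter.matrix : Letter → Matrix (Fin 2) (Fin 2) ℂ
  | Letter.I => 1
  | Letter.X => !![0, 1; 1, 0]
  | Letter.Y => !![0, -Complex.I; Complex.I, 0]
  | Letter.Z => !![1, 0; 0, -1]

/-- An element `i ^ phase · (σ₁ ⊗ ⋯ ⊗ σₙ)` of the `n`-qubit Pauli group. -/
structure Pauli (n : ℕ) where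
  phase : Fin 4
  letter : Fin n → Letter

namespace Pauli

def matrix {n : ℕ} (P : Pauli n) : Op n :=
  Complex.I ^ (P.phase : ℕ) • Matrix.of fun x y => ∏ j, (P.letter j).matrix (x j) (y j)

/-- The qubits on which a Pauli operator acts nontrivially. -/
def support {n : ℕ} (P : Pauli n) : Finset (Fin n) :=
  Finset.univ.filter fun j => P.letter j ≠ Letter.I

def weight {n : ℕ} (P : Pauli n) : ℕ := P.support.card

/-- The Pauli operator with letter `a` on qubit `i` and the identity elsewhere. -/
def single {n : ℕ} (i : Fin n) (a : Letter) : Pauli n :=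
  ⟨0, fun j => if j = i then a else Letter.I⟩

end Pauli

/-! ### Codes -/

/-- `S` is the stabilizer group of a stabilizer state: an Abelian group of `n`-qubit Pauli
operators of size `2 ^ n` that does not contain `-1`. -/
structure IsWordStabilizer {n : ℕ} (S : Subgroup (U n)) : Prop where
  pauli : ∀ g ∈ S, ∃ P : Pauli n, (g : Op n) = P.matrix
  comm : ∀ g ∈ S, ∀ h ∈ S, g * h = h * g
  neg_one : (-1 : U n) ∉ S
  card : Nat.card S = 2 ^ n

/-- `s` is a stabilizer state, i.e. a unit vector spanning an `[[n, 0]]` stabilizer code. -/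
def IsStabilizerState {n : ℕ} (s : H n) : Prop :=
  ‖s‖ = 1 ∧ ∃ S : Subgroup (U n), IsWordStabilizer S ∧ ∀ g ∈ S, act (g : Op n) s = s

/-- `Q` is a codeword-stabilized code of length `n` and dimension `K`: the span of the words
`W i |s⟩`, for `K` mutually commuting Pauli operators `W i` and a stabilizer state `|s⟩`. -/
def IsCWSCode {n : ℕ} (K : ℕ) (Q : Submodule ℂ (H n)) : Prop :=
  ∃ (s : H n) (W : Fin K → Pauli n),
    IsStabilizerState s ∧
    (∀ i j, (W i).matrix * (W j).matrix = (W j).matrix * (W i).matrix) ∧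
    Q = Submodule.span ℂ (Set.range fun i => act (W i).matrix s) ∧
    Module.finrank ℂ Q = K

/-- `M` acts on `Q` as a scalar. -/
def ActsTrivially {n : ℕ} (Q : Submodule ℂ (H n)) (M : Op n) : Prop :=
  ∃ c : ℂ, ∀ ψ ∈ Q, act M ψ = c • ψ

/-- A detectable error takes every nonzero code state out of the code, or acts trivially. -/
def Detectable {n : ℕ} (Q : Submodule ℂ (H n)) (M : Op n) : Prop :=
  (∀ ψ ∈ Q, ψ ≠ 0 → act M ψ ∉ Q) ∨ ActsTrivially Q M

/-- The Pauli errors of weight at most `t` are correctable: `E₁† E₂` is detectable for any two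
of them. -/
def IsErrorCorrecting {n : ℕ} (t : ℕ) (Q : Submodule ℂ (H n)) : Prop :=
  ∀ E₁ E₂ : Pauli n, E₁.weight ≤ t → E₂.weight ≤ t →
    Detectable Q (E₁.matrix.conjTranspose * E₂.matrix)

/-- The group generated by the single-qubit errors `X i`, `Z i` with `i ∈ A`. -/
def errorGroup {n : ℕ} (A : Finset (Fin n)) : Subgroup (U n) :=
  Subgroup.closure {g | ∃ i ∈ A,
    (g : Op n) = (Pauli.single i Letter.X).matrix ∨ (g : Op n) = (Pauli.single i Letter.Z).matrix}

/-- The space `G(Q)` spanned by all the images `g(Q)`, `g ∈ G`. For `G = errorGroup A` it is the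
auxiliary union stabilizer code of the cluster `A`. -/
def translate {n : ℕ} (G : Subgroup (U n)) (Q : Submodule ℂ (H n)) : Submodule ℂ (H n) :=
  ⨆ g ∈ G, Q.map (act (g : Op n))

/-! ### Circuits -/

/-- Gates on qubits labelled by `ι`: arbitrary one-qubit and two-qubit unitaries. -/
inductive Gate (ι : Type) where
  | one (q : ι) (u : Matrix.unitaryGroup (Fin 2) ℂ)
  | two (p q : ι) (hpq : p ≠ q) (u : Matrix.unitaryGroup (Fin 2 × Fin 2) ℂ)

namespace Gate

def apply {ι : Type} [Fintype ι] [DecidableEq ι] : Gate ι → Qubits ι → Qubits ι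
  | one q u, ψ => WithLp.toLp 2 fun x =>
      ∑ b, (u : Matrix (Fin 2) (Fin 2) ℂ) (x q) b * ψ (Function.update x q b)
  | two p q _ u, ψ => WithLp.toLp 2 fun x =>
      ∑ b, (u : Matrix (Fin 2 × Fin 2) (Fin 2 × Fin 2) ℂ) (x p, x q) b *
        ψ (Function.update (Function.update x p b.1) q b.2)

def isTwo {ι : Type} : Gate ι → Bool
  | one _ _ => false
  | two _ _ _ _ => true

end Gate

/-- A circuit is a list of gates, applied from left to right. -/
def run {ι : Type} [Fintype ι] [DecidableEq ι] (C : List (Gate ι)) (ψ : Qubits ι) : Qubits ι :=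
  C.foldl (fun φ g => g.apply φ) ψ

def twoQubitGates {ι : Type} (C : List (Gate ι)) : ℕ := C.countP Gate.isTwo

/-- The state `|ψ⟩ ⊗ |b⟩` of `n` data qubits and `a` ancillas. -/
def withAncillas {n a : ℕ} (ψ : H n) (b : Fin a → Fin 2) : Qubits (Fin n ⊕ Fin a) :=
  WithLp.toLp 2 fun x => if (fun j => x (Sum.inr j)) = b then ψ fun i => x (Sum.inl i) else 0

/-- The projective measurement of `V` against its orthogonal complement can be done with at most
`g` two-qubit gates: some circuit on the data qubits and ancillas in the state `|0⟩` takes each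
`ψ` to `P ψ ⊗ |1⟩ + (1 - P) ψ ⊗ |0⟩`, where `P` is the orthogonal projector onto `V` and the
second factor is the ancilla to be read out, the other ancillas having returned to `|0⟩`. -/
def MeasurableWith {n : ℕ} (V : Submodule ℂ (H n)) (g : ℕ) : Prop :=
  ∃ (a : ℕ) (C : List (Gate (Fin n ⊕ Fin (a + 1)))), twoQubitGates C ≤ g ∧
    ∀ ψ : H n, run C (withAncillas ψ 0) =
      withAncillas (V.starProjection ψ) (Pi.single 0 1) +
        withAncillas (ψ - V.starProjection ψ) 0

/-! ### Adaptive error correction -/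

/-- An adaptive procedure: `measure V yes no` measures the projector onto `V` and proceeds
according to the outcome; `recover R` declares the error to be `R` and applies `R†`. -/
inductive Protocol (n : ℕ) where
  | recover (R : Pauli n)
  | measure (V : Submodule ℂ (H n)) (yes no : Protocol n)

namespace Protocol

/-- The largest number of measurements made along any sequence of outcomes. -/
def depth {n : ℕ} : Protocol n → ℕ
  | recover _ => 0
  | measure _ yes no => max yes.depth no.depth + 1

/-- Every measurement that may be made satisfies `p`. -/
def AllMeasurements {n : ℕ} (p : Submodule ℂ (H n) → Prop) : Protocol n → Prop
  | recover _ => True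
  | measure V yes no => p V ∧ yes.AllMeasurements p ∧ no.AllMeasurements p

/-- For each sequence of outcomes, the product of the corresponding projectors (which takes
the initial state to the unnormalized final state) and the error that is declared. -/
def branches {n : ℕ} : Protocol n → List ((H n →ₗ[ℂ] H n) × Pauli n)
  | recover R => [(LinearMap.id, R)]
  | measure V yes no =>
      (yes.branches.map fun b => (b.1 ∘ₗ V.starProjection.toLinearMap, b.2)) ++
      (no.branches.map fun b => (b.1 ∘ₗ (LinearMap.id - V.starProjection.toLinearMap), b.2))

/-- All Pauli errors of weight at most `t` on `Q` are corrected: for each sequence of outcomes,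
the recovered state is the original code state, up to a factor independent of that state. (By
linearity the same follows for linear combinations of these errors.) -/
def Corrects {n : ℕ} (Q : Submodule ℂ (H n)) (t : ℕ) (p : Protocol n) : Prop :=
  ∀ E : Pauli n, E.weight ≤ t → ∀ b ∈ p.branches, ∃ c : ℂ, ∀ ψ ∈ Q,
    act b.2.matrix.conjTranspose (b.1 (act E.matrix ψ)) = c • ψ

/-- All Pauli errors of weight at most `t` on `Q` are identified: for each sequence of outcomes,
either it never occurs, or the measurements leave the corrupted state intact and the declared
error has weight at most `t` and is degenerate with the actual one. -/
def Identifies {n : ℕ} (Q : Submodule ℂ (H n)) (t : ℕ) (p : Protocol n) : Prop :=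
  ∀ E : Pauli n, E.weight ≤ t → ∀ b ∈ p.branches,
    (∀ ψ ∈ Q, b.1 (act E.matrix ψ) = 0) ∨
    ((∀ ψ ∈ Q, b.1 (act E.matrix ψ) = act E.matrix ψ) ∧ b.2.weight ≤ t ∧
      ActsTrivially Q (b.2.matrix.conjTranspose * E.matrix))

/-- Only subgroup tests for the cluster `A`: each measurement is onto `G(Q)` for a subgroup `G`
of the errors located on `A`, and each declared error is located on `A`. -/
def IsSubgroupTesting {n : ℕ} (Q : Submodule ℂ (H n)) (A : Finset (Fin n)) : Protocol n → Prop
  | recover R => R.support ⊆ A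
  | measure V yes no =>
      (∃ G : Subgroup (U n), G ≤ errorGroup A ∧ V = translate G Q) ∧
        yes.IsSubgroupTesting Q A ∧ no.IsSubgroupTesting Q A

/-- Clustered measurements for a list of clusters: the projectors onto the auxiliary codes of
the clusters are measured one after the other, except that of the last cluster; for the first
cluster with a positive outcome (the last cluster if there is none), at most `m` subgroup tests
follow. -/
def IsClustered {n : ℕ} (Q : Submodule ℂ (H n)) (m : ℕ) :
    List (Finset (Fin n)) → Protocol n → Prop
  | [], _ => False
  | [A], p => p.IsSubgroupTesting Q A ∧ p.depth ≤ m
  | A :: B :: L, p => ∃ yes no : Protocol n,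
      p = measure (translate (errorGroup A) Q) yes no ∧
        yes.IsSubgroupTesting Q A ∧ yes.depth ≤ m ∧ no.IsClustered Q m (B :: L)

end Protocol

end

end CWS

namespace CWS

noncomputable section

/-! ### Action of matrices on states -/

/-! Two facts about a stabilizer state carry the proof: the average of its stabilizer group is the
projector onto it (`sum_stabilizer`), and a Pauli operator maps it to a multiple of itself or to an
orthogonal state (`pauli_act_stabilizerState`). On a CWS code the second fact sharpens detectability
to a dichotomy (`degenerate_or_orthogonal`): two Pauli errors of weight at most `t` are degenerate
or send `Q` to orthogonal spaces.

Identification. If `A` has `t` qubits, every error `E` of weight at most `t` is degenerate with an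
error on `A`, or sends `Q` into the orthogonal complement of the cluster code. So each cluster
measurement has a certain outcome and disturbs nothing (`handles_measure`), and the last cluster is
left by elimination. On `A`, squares and commutators are scalars, so the error group modulo its
trivially acting elements is an elementary abelian 2-group, of order at most `4 ^ t`
(`relIndex_trivialSubgroup`). Hence `2 * t` subgroups of index two meet exactly in the trivially
acting elements (`exists_separating_subgroups`), and testing them determines the error up to
degeneracy.

Cost. Averaging over `G` (`mem_span_of_fixed`) shows that `G(Q)` is spanned by at most `K` joint
eigenspaces of the stabilizers commuting with `G`, one sign pattern per word (`translate_eq_span`).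
Distinct patterns are orthogonal, so a circuit may flip one readout ancilla for each of them in turn
(`run_flatMap_flipIf`), every flip being a chain of Hadamard tests that is afterwards undone
(`run_flipIf_on`). If the commuting stabilizers form a proper subgroup, `n - 1` generators suffice.
Otherwise `n` generators of full weight would exceed the bound by 3 gates per word; but `G` contains
an operator of weight one (`exists_weight_one`), so the stabilizer does too, and the other
generators can be chosen trivial on that qubit (`measurableWith_translate`). -/

theorem act_mul {n : ℕ} (M N : Op n) (ψ : H n) : act (M * N) ψ = act M (act N ψ) := by
  simp [act]

@[simp] theorem act_one {n : ℕ} (ψ : H n) : act (1 : Op n) ψ = ψ := by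
  simp [act]

@[simp] theorem act_smul {n : ℕ} (c : ℂ) (M : Op n) (ψ : H n) : act (c • M) ψ = c • act M ψ := by
  simp [act]

@[simp] theorem act_neg {n : ℕ} (M : Op n) (ψ : H n) : act (-M) ψ = -act M ψ := by
  simp [act]

theorem act_sum {n : ℕ} {ι : Type*} (s : Finset ι) (M : ι → Op n) (ψ : H n) :
    act (∑ i ∈ s, M i) ψ = ∑ i ∈ s, act (M i) ψ := by
  simp [act]

theorem act_apply {n : ℕ} (M : Op n) (ψ : H n) (x : Fin n → Fin 2) :
    act M ψ x = ∑ y, M x y * ψ y := by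
  simp [act, Matrix.toLpLin_apply, Matrix.mulVec, dotProduct]

theorem inner_act_left {n : ℕ} (M : Op n) (ψ φ : H n) :
    inner ℂ (act M ψ) φ = inner ℂ ψ (act M.conjTranspose φ) := by
  have h : act M.conjTranspose = (act M).adjoint := Matrix.toEuclideanLin_conjTranspose_eq_adjoint M
  rw [h, LinearMap.adjoint_inner_right]

theorem inner_act_right {n : ℕ} (M : Op n) (ψ φ : H n) :
    inner ℂ ψ (act M φ) = inner ℂ (act M.conjTranspose ψ) φ := by
  rw [inner_act_left, Matrix.conjTranspose_conjTranspose]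

/-! ### Tensor products of one-qubit operators -/

/-- The tensor product of one-qubit operators. -/
def tens {n : ℕ} (f : Fin n → Matrix (Fin 2) (Fin 2) ℂ) : Op n :=
  Matrix.of fun x y => ∏ j, f j (x j) (y j)

theorem tens_mul {n : ℕ} (f g : Fin n → Matrix (Fin 2) (Fin 2) ℂ) :
    tens f * tens g = tens fun j => f j * g j := by
  ext x y
  simp only [tens, Matrix.mul_apply, Matrix.of_apply]
  rw [Finset.prod_univ_sum]
  simp [Finset.prod_mul_distrib]

theorem tens_one {n : ℕ} : tens (fun _ : Fin n => 1) = 1 := by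
  ext x y
  simp only [tens, Matrix.of_apply, Matrix.one_apply]
  by_cases h : x = y
  · simp [h]
  · obtain ⟨j, hj⟩ := Function.ne_iff.mp h
    rw [if_neg h]
    exact Finset.prod_eq_zero (Finset.mem_univ j) (by simp [hj])

theorem tens_conjTranspose {n : ℕ} (f : Fin n → Matrix (Fin 2) (Fin 2) ℂ) :
    (tens f).conjTranspose = tens fun j => (f j).conjTranspose := by
  ext x y
  simp [tens, Matrix.conjTranspose_apply]

theorem tens_smul {n : ℕ} (c : Fin n → ℂ) (f : Fin n → Matrix (Fin 2) (Fin 2) ℂ) :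
    tens (fun j => c j • f j) = (∏ j, c j) • tens f := by
  ext x y
  simp [tens, Finset.prod_mul_distrib]

theorem trace_tens {n : ℕ} (f : Fin n → Matrix (Fin 2) (Fin 2) ℂ) :
    (tens f).trace = ∏ j, (f j).trace := by
  simp only [tens, Matrix.trace, Matrix.diag, Matrix.of_apply]
  rw [Finset.prod_univ_sum]
  simp

/-! ### One-qubit Pauli matrices -/

namespace Letter

/-- The product of two letters up to a phase. -/
def mul : Letter → Letter → Letter
  | I, b => b
  | a, I => a
  | X, X => I
  | Y, Y => I
  | Z, Z => I
  | X, Y => Z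
  | Y, X => Z
  | Y, Z => X
  | Z, Y => X
  | Z, X => Y
  | X, Z => Y

/-- The exponent of `i` in the product of two letters. -/
def mulPhase : Letter → Letter → ℕ
  | X, Y => 1
  | Y, X => 3
  | Y, Z => 1
  | Z, Y => 3
  | Z, X => 1
  | X, Z => 3
  | _, _ => 0

/-- The sign in the commutation relation of two letters. -/
def sgn (a b : Letter) : ℂ := if a = I ∨ b = I ∨ a = b then 1 else -1

theorem matrix_mul (a b : Letter) :
    a.matrix * b.matrix = Complex.I ^ mulPhase a b • (mul a b).matrix := by
  cases a <;> cases b <;> ext i j <;> fin_cases i <;> fin_cases j <;>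
    simp [matrix, mul, mulPhase, pow_succ]

theorem matrix_comm (a b : Letter) : a.matrix * b.matrix = sgn a b • (b.matrix * a.matrix) := by
  cases a <;> cases b <;> ext i j <;> fin_cases i <;> fin_cases j <;> simp [matrix, sgn]

theorem matrix_mul_self (a : Letter) : a.matrix * a.matrix = 1 := by
  cases a <;> ext i j <;> fin_cases i <;> fin_cases j <;> simp [matrix]

theorem matrix_conjTranspose (a : Letter) : a.matrix.conjTranspose = a.matrix := by
  cases a <;> ext i j <;> fin_cases i <;> fin_cases j <;> simp [matrix, Matrix.conjTranspose_apply]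

theorem trace_matrix (a : Letter) (h : a ≠ I) : a.matrix.trace = 0 := by
  cases a <;> simp_all [matrix, Matrix.trace]

theorem mul_eq_I (a b : Letter) (h : mul a b = I) : a = b := by
  cases a <;> cases b <;> simp_all [mul]

/-- An enumeration of the letters. -/
def code : Letter → Fin 4
  | I => 0
  | X => 1
  | Y => 2
  | Z => 3

theorem code_injective : Function.Injective code := by
  intro a b; cases a <;> cases b <;> simp [code]

theorem sgn_eq (a b : Letter) : sgn a b = 1 ∨ sgn a b = -1 := by
  unfold sgn; split_ifs <;> simp

end Letter

/-! ### Pauli operators -/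

namespace Pauli

variable {n : ℕ}

theorem matrix_eq (P : Pauli n) :
    P.matrix = Complex.I ^ (P.phase : ℕ) • tens fun j => (P.letter j).matrix := rfl

theorem I_pow_ofNat (k : ℕ) : Complex.I ^ (Fin.ofNat 4 k : ℕ) = Complex.I ^ k := by
  conv_rhs => rw [← Nat.div_add_mod k 4, pow_add, pow_mul, Complex.I_pow_four, one_pow, one_mul]
  rfl

/-- The product of two Pauli operators. -/
def mul (P Q : Pauli n) : Pauli n :=
  ⟨Fin.ofNat 4 (P.phase + Q.phase + ∑ j, Letter.mulPhase (P.letter j) (Q.letter j)),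
    fun j => Letter.mul (P.letter j) (Q.letter j)⟩

theorem matrix_mul (P Q : Pauli n) : P.matrix * Q.matrix = (P.mul Q).matrix := by
  simp only [matrix_eq, mul, I_pow_ofNat, smul_mul_smul_comm, tens_mul, Letter.matrix_mul,
    tens_smul, smul_smul, Finset.prod_pow_eq_pow_sum, pow_add]

/-- The negative of a Pauli operator. -/
def neg (P : Pauli n) : Pauli n := ⟨Fin.ofNat 4 (P.phase + 2), P.letter⟩

theorem matrix_neg (P : Pauli n) : P.neg.matrix = -P.matrix := by
  simp only [matrix_eq, neg, I_pow_ofNat, pow_add, Complex.I_sq, mul_neg, mul_one, neg_smul]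

@[simp] theorem weight_neg (P : Pauli n) : P.neg.weight = P.weight := rfl

/-- The adjoint of a Pauli operator. -/
def adj (P : Pauli n) : Pauli n := ⟨Fin.ofNat 4 (3 * P.phase), P.letter⟩

theorem matrix_adj (P : Pauli n) : P.adj.matrix = P.matrix.conjTranspose := by
  simp only [matrix_eq, adj, I_pow_ofNat, Matrix.conjTranspose_smul, tens_conjTranspose,
    Letter.matrix_conjTranspose, pow_mul, Complex.I_pow_three]
  simp

/-- The identity as a Pauli operator. -/
def one (n : ℕ) : Pauli n := ⟨0, fun _ => Letter.I⟩

@[simp] theorem matrix_one : (one n).matrix = 1 := by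
  simp [matrix_eq, one, Letter.matrix, tens_one]

@[simp] theorem support_one : (one n).support = ∅ := by
  simp [support, one]

theorem mem_support {P : Pauli n} {j : Fin n} : j ∈ P.support ↔ P.letter j ≠ Letter.I := by
  simp [support]

theorem norm_I_pow (k : ℕ) : star (Complex.I ^ k) * Complex.I ^ k = 1 := by
  rw [star_pow, ← mul_pow]; simp

theorem conjTranspose_mul_self (P : Pauli n) : P.matrix.conjTranspose * P.matrix = 1 := by
  rw [matrix_eq, Matrix.conjTranspose_smul, tens_conjTranspose, smul_mul_smul_comm, tens_mul,
    norm_I_pow, one_smul]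
  simp [Letter.matrix_conjTranspose, Letter.matrix_mul_self, tens_one]

theorem mul_conjTranspose_self (P : Pauli n) : P.matrix * P.matrix.conjTranspose = 1 :=
  mul_eq_one_comm.mp P.conjTranspose_mul_self

/-- A Pauli operator as a unitary. -/
def toU (P : Pauli n) : U n := ⟨P.matrix, by
  rw [Matrix.mem_unitaryGroup_iff]; exact P.mul_conjTranspose_self⟩

@[simp] theorem coe_toU (P : Pauli n) : (P.toU : Op n) = P.matrix := rfl

/-- The sign in the commutation relation of two Pauli operators. -/
def sgn (P Q : Pauli n) : ℂ := ∏ j, Letter.sgn (P.letter j) (Q.letter j)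

theorem matrix_comm (P Q : Pauli n) : P.matrix * Q.matrix = sgn P Q • (Q.matrix * P.matrix) := by
  simp only [matrix_eq, smul_mul_smul_comm, tens_mul, sgn]
  conv_lhs => enter [2, 1]; ext j; rw [Letter.matrix_comm]
  rw [tens_smul, smul_smul, smul_smul, mul_comm (_ * _), mul_comm (Complex.I ^ _)]

theorem sgn_eq (P Q : Pauli n) : sgn P Q = 1 ∨ sgn P Q = -1 :=
  Finset.prod_induction _ (fun c : ℂ => c = 1 ∨ c = -1)
    (by rintro a b (rfl | rfl) (rfl | rfl) <;> simp) (Or.inl rfl) fun _ _ => Letter.sgn_eq _ _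

theorem sgn_mul_self (P Q : Pauli n) : sgn P Q * sgn P Q = 1 := by
  rcases sgn_eq P Q with h | h <;> simp [h]

theorem comm_or_anticomm (P Q : Pauli n) :
    P.matrix * Q.matrix = Q.matrix * P.matrix ∨ P.matrix * Q.matrix = -(Q.matrix * P.matrix) := by
  rw [matrix_comm P Q]
  rcases sgn_eq P Q with h | h <;> simp [h]

theorem matrix_mul_self (P : Pauli n) : P.matrix * P.matrix = 1 ∨ P.matrix * P.matrix = -1 := by
  have h : P.matrix * P.matrix = (Complex.I ^ (2 * (P.phase : ℕ))) • (1 : Op n) := by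
    simp only [matrix_eq, smul_mul_smul_comm, tens_mul, Letter.matrix_mul_self, tens_one, ← pow_add,
      two_mul]
  rw [h, pow_mul, Complex.I_sq]
  rcases neg_one_pow_eq_or ℂ (P.phase : ℕ) with h | h <;> simp [h]

theorem trace_matrix (P : Pauli n) (j : Fin n) (hj : P.letter j ≠ Letter.I) :
    P.matrix.trace = 0 := by
  rw [matrix_eq, Matrix.trace_smul, trace_tens,
    Finset.prod_eq_zero (Finset.mem_univ j) (Letter.trace_matrix _ hj), smul_zero]

theorem matrix_of_letter_eq_I (P : Pauli n) (h : ∀ j, P.letter j = Letter.I) :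
    P.matrix = Complex.I ^ (P.phase : ℕ) • (1 : Op n) := by
  simp [matrix_eq, h, Letter.matrix, tens_one]

theorem matrix_of_letter_eq (P Q : Pauli n) (h : P.letter = Q.letter) :
    ∃ c : ℂ, P.matrix = c • Q.matrix := by
  refine ⟨Complex.I ^ (P.phase : ℕ) * star (Complex.I ^ (Q.phase : ℕ)), ?_⟩
  rw [matrix_eq, matrix_eq, smul_smul, mul_assoc, norm_I_pow, h, mul_one]

theorem matrix_ne_zero (P : Pauli n) : P.matrix ≠ 0 := by
  intro h
  have := P.conjTranspose_mul_self
  rw [h, mul_zero] at this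
  exact zero_ne_one this

theorem finite : Finite (Pauli n) := by
  have : Finite Letter := Finite.of_injective _ Letter.code_injective
  exact Finite.of_injective (fun P : Pauli n => (P.phase, P.letter))
    fun P Q h => by cases P; cases Q; simpa using h

theorem support_mul (P Q : Pauli n) (A : Finset (Fin n)) (hP : P.support ⊆ A)
    (hQ : Q.support ⊆ A) : (P.mul Q).support ⊆ A := by
  intro j hj
  rw [mem_support] at hj
  by_contra hA
  have h1 : P.letter j = Letter.I := by
    by_contra h; exact hA (hP (mem_support.mpr h))
  have h2 : Q.letter j = Letter.I := by
    by_contra h; exact hA (hQ (mem_support.mpr h))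
  exact hj (by simp [mul, h1, h2, Letter.mul])

theorem sgn_single (P : Pauli n) (Q : Pauli n) (i : Fin n) (h : Q.support ⊆ {i}) :
    sgn P Q = Letter.sgn (P.letter i) (Q.letter i) := by
  refine Finset.prod_eq_single i (fun j _ hj => ?_) (by simp)
  have : Q.letter j = Letter.I := by
    by_contra h'
    exact hj (Finset.mem_singleton.mp (h (mem_support.mpr h')))
  simp [Letter.sgn, this]

theorem support_single (i : Fin n) (a : Letter) : (single i a).support ⊆ {i} := by
  intro j hj
  rw [mem_support] at hj
  by_contra h
  exact hj (by simp [single, Finset.mem_singleton.not.mp h])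

end Pauli

/-! ### The group of errors on a cluster -/

theorem exists_pauli_of_mem_errorGroup {n : ℕ} {A : Finset (Fin n)} {g : U n}
    (hg : g ∈ errorGroup A) : ∃ P : Pauli n, P.support ⊆ A ∧ (g : Op n) = P.matrix := by
  induction hg using Subgroup.closure_induction with
  | mem x hx =>
    obtain ⟨i, hi, h | h⟩ := hx
    · exact ⟨_, (Pauli.support_single i _).trans (by simpa using hi), h⟩
    · exact ⟨_, (Pauli.support_single i _).trans (by simpa using hi), h⟩
  | one => exact ⟨Pauli.one n, by simp, by simp⟩
  | mul x y _ _ hx hy =>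
    obtain ⟨P, hP, hP'⟩ := hx
    obtain ⟨Q, hQ, hQ'⟩ := hy
    exact ⟨P.mul Q, P.support_mul Q A hP hQ, by simp [← Pauli.matrix_mul, hP', hQ']⟩
  | inv x _ hx =>
    obtain ⟨P, hP, hP'⟩ := hx
    exact ⟨P.adj, hP, by rw [Pauli.matrix_adj, ← hP']; rfl⟩

theorem toU_single_mem_errorGroup {n : ℕ} {A : Finset (Fin n)} {i : Fin n} (hi : i ∈ A)
    (a : Letter) : ∃ g ∈ errorGroup A, ∃ c : ℂ, (Pauli.single i a).matrix = c • (g : Op n) := by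
  have hX : (Pauli.single i Letter.X).toU ∈ errorGroup A :=
    Subgroup.subset_closure ⟨i, hi, Or.inl rfl⟩
  have hZ : (Pauli.single i Letter.Z).toU ∈ errorGroup A :=
    Subgroup.subset_closure ⟨i, hi, Or.inr rfl⟩
  cases a with
  | I =>
    obtain ⟨c, hc⟩ := Pauli.matrix_of_letter_eq (Pauli.single i Letter.I) (Pauli.one n) (by
      ext j; simp [Pauli.single, Pauli.one])
    exact ⟨1, one_mem _, c, by simpa using hc⟩
  | X => exact ⟨_, hX, 1, by simp⟩
  | Z => exact ⟨_, hZ, 1, by simp⟩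
  -- The product of `X` and `Z` is `Y` only up to a factor of `i`, which is why a scalar is allowed.
  | Y =>
    refine ⟨_, mul_mem hX hZ, ?_⟩
    obtain ⟨c, hc⟩ := Pauli.matrix_of_letter_eq (Pauli.single i Letter.Y)
      ((Pauli.single i Letter.X).mul (Pauli.single i Letter.Z)) (by
        ext j; by_cases h : j = i <;> simp [Pauli.single, Pauli.mul, h, Letter.mul])
    exact ⟨c, by rw [hc, ← Pauli.matrix_mul]; rfl⟩

/-- The generators are real matrices, so operators with an imaginary phase are missing from the
group and membership can only hold up to a scalar. The proof splits off one qubit of the support at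
a time. -/
theorem exists_mem_errorGroup {n : ℕ} (A : Finset (Fin n)) (P : Pauli n) (hP : P.support ⊆ A) :
    ∃ g ∈ errorGroup A, ∃ c : ℂ, P.matrix = c • (g : Op n) := by
  obtain ⟨B, hB⟩ : ∃ B, B = P.support := ⟨_, rfl⟩
  induction B using Finset.induction_on generalizing P with
  | empty =>
    refine ⟨1, one_mem _, Complex.I ^ (P.phase : ℕ), ?_⟩
    rw [P.matrix_of_letter_eq_I]; · rfl
    intro j
    by_contra h
    simpa [← hB] using Pauli.mem_support.mpr h
  | insert i B hi ih =>
    have hiP : i ∈ P.support := hB ▸ Finset.mem_insert_self i B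
    let P' : Pauli n := ⟨0, Function.update P.letter i Letter.I⟩
    have hP' : P'.support = B := by
      ext j
      rw [Pauli.mem_support]
      by_cases h : j = i
      · subst h; simp [P', hi]
      · have : j ∈ P.support ↔ j ∈ B := by rw [← hB]; simp [h]
        rw [← this, Pauli.mem_support]; simp [P', h]
    obtain ⟨g, hg, c, hc⟩ := ih P' (hP'.trans_subset ((Finset.subset_insert i B).trans (hB ▸ hP)))
      hP'.symm
    obtain ⟨g', hg', c', hc'⟩ := toU_single_mem_errorGroup (hP hiP) (P.letter i)
    obtain ⟨d, hd⟩ := Pauli.matrix_of_letter_eq P ((Pauli.single i (P.letter i)).mul P') (by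
        ext j; by_cases h : j = i
        · subst h; cases P.letter j <;> simp [Pauli.single, Pauli.mul, Letter.mul, P']
        · simp [Pauli.single, Pauli.mul, h, Letter.mul, P'])
    refine ⟨g' * g, mul_mem hg' hg, d * (c' * c), ?_⟩
    rw [hd, ← Pauli.matrix_mul, hc, hc', smul_mul_smul_comm, smul_smul]; rfl

/-! ### Stabilizer groups -/

@[simp] theorem coe_neg_unitary {n : ℕ} (g : U n) : ((-g : U n) : Op n) = -(g : Op n) := rfl

open scoped ComplexOrder in
theorem eq_zero_of_trace_conjTranspose_mul_self {n : ℕ} {M : Op n}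
    (h : (M.conjTranspose * M).trace = 0) : M = 0 :=
  Matrix.trace_conjTranspose_mul_self_eq_zero_iff.mp h

theorem two_pow_ne_zero (n : ℕ) : (2 ^ n : ℂ) ≠ 0 := pow_ne_zero n two_ne_zero

theorem eq_zero_of_eq_neg {n : ℕ} {φ : H n} (h : φ = -φ) : φ = 0 := by
  have h2 : (2 : ℂ) • φ = 0 := by
    rw [two_smul]; nth_rw 1 [h]; exact neg_add_cancel φ
  exact (smul_eq_zero_iff_right two_ne_zero).mp h2

namespace IsWordStabilizer

variable {n : ℕ} {S : Subgroup (U n)}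

theorem finite (hS : IsWordStabilizer S) : Finite S :=
  Nat.finite_of_card_ne_zero (by rw [hS.card]; positivity)

theorem mul_self (hS : IsWordStabilizer S) {g : U n} (hg : g ∈ S) : g * g = 1 := by
  obtain ⟨P, hP⟩ := hS.pauli g hg
  rcases P.matrix_mul_self with h | h
  · exact Subtype.ext (by simp [hP, h])
  · have : g * g = -1 := Subtype.ext (by simp [hP, h])
    exact absurd (this ▸ mul_mem hg hg) hS.neg_one

theorem conjTranspose (hS : IsWordStabilizer S) {g : U n} (hg : g ∈ S) :
    (g : Op n).conjTranspose = g := by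
  have h : star g = g := by
    rw [Unitary.star_eq_inv]; exact inv_eq_of_mul_eq_one_left (hS.mul_self hg)
  exact congrArg Subtype.val h

/-- A multiple of the identity that squares to 1 is 1 or -1, and -1 is excluded from the stabilizer.
-/
theorem letter_ne (hS : IsWordStabilizer S) {g : U n} (hg : g ∈ S) (h1 : g ≠ 1) {P : Pauli n}
    (hP : (g : Op n) = P.matrix) : ∃ j, P.letter j ≠ Letter.I := by
  by_contra! h
  have hm := P.matrix_of_letter_eq_I h
  rw [← hP] at hm
  have h2 : (g : Op n) * g = 1 := congrArg Subtype.val (hS.mul_self hg)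
  have hk : (Complex.I ^ (P.phase : ℕ)) ^ 2 = 1 := by
    rw [hm, smul_mul_smul_comm, mul_one, ← sq] at h2
    have := congrFun₂ h2 0 0
    simpa using this
  rcases eq_or_eq_neg_of_sq_eq_sq _ 1 (hk.trans (one_pow 2).symm) with h | h
  · exact h1 (Subtype.ext (by simp [hm, h]))
  · have : g = -1 := Subtype.ext (by simp [hm, h])
    exact hS.neg_one (this ▸ hg)

theorem trace (hS : IsWordStabilizer S) {g : U n} (hg : g ∈ S) (h1 : g ≠ 1) :
    (g : Op n).trace = 0 := by
  obtain ⟨P, hP⟩ := hS.pauli g hg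
  obtain ⟨j, hj⟩ := hS.letter_ne hg h1 hP
  rw [hP, P.trace_matrix j hj]

end IsWordStabilizer

/-- The rank-one operator `|s⟩⟨s|`. -/
def ketBra {n : ℕ} (s : H n) : Op n := Matrix.vecMulVec (fun x => s x) (fun x => star (s x))

theorem act_ketBra {n : ℕ} (s φ : H n) : act (ketBra s) φ = (inner ℂ s φ : ℂ) • s := by
  ext x
  simp only [act_apply, ketBra, Matrix.vecMulVec_apply, PiLp.smul_apply, PiLp.inner_apply,
    smul_eq_mul, Finset.sum_mul, RCLike.inner_apply]
  refine Finset.sum_congr rfl fun y _ => ?_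
  simp only [starRingEnd_apply]; ring

theorem ext_act {n : ℕ} {M N : Op n} (h : ∀ φ, act M φ = act N φ) : M = N :=
  Matrix.toEuclideanLin.injective (LinearMap.ext h)

theorem ketBra_conjTranspose {n : ℕ} (s : H n) : (ketBra s).conjTranspose = ketBra s := by
  ext x y
  simp [ketBra, Matrix.vecMulVec_apply, Matrix.conjTranspose_apply, mul_comm]

theorem mul_ketBra {n : ℕ} (M : Op n) (s : H n) (h : act M s = s) : M * ketBra s = ketBra s :=
  ext_act fun φ => by rw [act_mul, act_ketBra, map_smul, h]

theorem trace_mul_ketBra {n : ℕ} (M : Op n) (s : H n) :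
    (M * ketBra s).trace = inner ℂ s (act M s) := by
  rw [ketBra, Matrix.mul_vecMulVec, Matrix.trace_vecMulVec]
  simp only [dotProduct, Matrix.mulVec, PiLp.inner_apply, act_apply, RCLike.inner_apply,
    starRingEnd_apply]

/-- The projector onto a stabilizer state is the average of its stabilizer group. -/
theorem sum_stabilizer {n : ℕ} {S : Subgroup (U n)} (hS : IsWordStabilizer S) [Fintype S] {s : H n}
    (hs : ‖s‖ = 1) (hfix : ∀ g ∈ S, act (g : Op n) s = s) :
    ∑ h : S, ((h : U n) : Op n) = (2 ^ n : ℂ) • ketBra s := by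
  set T : Op n := ∑ h : S, ((h : U n) : Op n) with hT
  have hcard : (Fintype.card S : ℂ) = 2 ^ n := by
    rw [← Nat.card_eq_fintype_card, hS.card]; simp
  have h2 : (2 ^ n : ℂ) ≠ 0 := two_pow_ne_zero n
  have hgT : ∀ g : S, ((g : U n) : Op n) * T = T := fun g => by
    rw [hT, Finset.mul_sum]
    exact Fintype.sum_equiv (Equiv.mulLeft g) _ _ fun h => by simp
  have hTT : T * T = (2 ^ n : ℂ) • T := by
    nth_rw 1 [hT]
    rw [Finset.sum_mul, Finset.sum_congr rfl fun g _ => hgT g, Finset.sum_const, ← hcard,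
      Finset.card_univ, Nat.cast_smul_eq_nsmul]
  have hTc : T.conjTranspose = T := by
    rw [hT, Matrix.conjTranspose_sum]
    exact Finset.sum_congr rfl fun g _ => hS.conjTranspose g.2
  have hTD : T * ketBra s = (2 ^ n : ℂ) • ketBra s := by
    rw [hT, Finset.sum_mul, Finset.sum_congr rfl fun (g : S) _ => mul_ketBra _ s (hfix g g.2),
      Finset.sum_const, ← hcard, Finset.card_univ, Nat.cast_smul_eq_nsmul]
  have hDT : ketBra s * T = (2 ^ n : ℂ) • ketBra s := by
    have := congrArg Matrix.conjTranspose hTD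
    simpa [Matrix.conjTranspose_mul, ketBra_conjTranspose, hTc] using this
  have hss : (inner ℂ s s : ℂ) = 1 := by rw [inner_self_eq_norm_sq_to_K, hs]; simp
  have hDD : ketBra s * ketBra s = ketBra s :=
    mul_ketBra _ _ (by rw [act_ketBra, hss, one_smul])
  have htrT : T.trace = 2 ^ n := by
    rw [hT, Matrix.trace_sum, Finset.sum_eq_single (1 : S)]
    · simp [Matrix.trace_one]
    · intro g _ hg
      exact hS.trace g.2 fun h => hg (Subtype.ext h)
    · simp
  have htrD : (ketBra s).trace = 1 := by
    have := trace_mul_ketBra 1 s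
    rwa [one_mul, act_one, hss] at this
  -- The difference of the normalized sum and `ketBra s` is a self-adjoint idempotent of trace 1 - 1
  -- = 0, hence zero.
  set M : Op n := (2 ^ n : ℂ)⁻¹ • T - ketBra s with hM
  have hMc : M.conjTranspose = M := by
    simp [hM, ketBra_conjTranspose, hTc]
  have hMM : M * M = M := by
    simp only [hM, mul_sub, sub_mul, smul_mul_assoc, mul_smul_comm, hTT, hTD, hDT, hDD, smul_smul,
      smul_sub, inv_mul_cancel₀ h2, one_smul, sub_self, sub_zero]
  have hM0 : M = 0 := by
    apply eq_zero_of_trace_conjTranspose_mul_self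
    rw [hMc, hMM, hM, Matrix.trace_sub,
      Matrix.trace_smul, htrT, htrD, smul_eq_mul, inv_mul_cancel₀ h2, sub_self]
  have : (2 ^ n : ℂ)⁻¹ • T = ketBra s := sub_eq_zero.mp (hM ▸ hM0)
  rw [← this, smul_smul, mul_inv_cancel₀ h2, one_smul]

section
variable {n : ℕ} {S : Subgroup (U n)} {s : H n}

/-- Since `M` commutes with `S`, the vector `M s` is fixed by `S`, hence by the average of `S`,
which is the projector onto `s`. -/
theorem act_eq_smul_of_comm (hS : IsWordStabilizer S) (hs : ‖s‖ = 1)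
    (hfix : ∀ g ∈ S, act (g : Op n) s = s) (M : Op n)
    (hM : ∀ g ∈ S, M * (g : Op n) = (g : Op n) * M) :
    act M s = (inner ℂ s (act M s) : ℂ) • s := by
  have := hS.finite
  have := Fintype.ofFinite S
  have hcard : (Fintype.card S : ℂ) = 2 ^ n := by
    rw [← Nat.card_eq_fintype_card, hS.card]; simp
  have h2 : (2 ^ n : ℂ) ≠ 0 := two_pow_ne_zero n
  have h := congrArg (fun T => act T (act M s)) (sum_stabilizer hS hs hfix)
  simp only [act_sum, act_smul, act_ketBra] at h
  rw [Finset.sum_congr rfl fun (g : S) _ => by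
    rw [← act_mul, ← hM g g.2, act_mul, hfix g g.2], Finset.sum_const, Finset.card_univ,
    ← Nat.cast_smul_eq_nsmul ℂ, hcard] at h
  exact smul_right_injective _ h2 h

/-- A Pauli operator either multiplies a stabilizer state by a scalar or takes it to an
orthogonal state. -/
theorem pauli_act_stabilizerState (hS : IsWordStabilizer S) (hs : ‖s‖ = 1)
    (hfix : ∀ g ∈ S, act (g : Op n) s = s) (P : Pauli n) :
    (∃ c : ℂ, act P.matrix s = c • s) ∨ (inner ℂ s (act P.matrix s) : ℂ) = 0 := by
  by_cases h : ∀ g ∈ S, P.matrix * (g : Op n) = (g : Op n) * P.matrix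
  · exact Or.inl ⟨_, act_eq_smul_of_comm hS hs hfix _ h⟩
  · push Not at h
    obtain ⟨g, hg, hne⟩ := h
    obtain ⟨R, hR⟩ := hS.pauli g hg
    right
    have hanti : P.matrix * (g : Op n) = -((g : Op n) * P.matrix) := by
      rw [hR] at hne ⊢
      exact (P.comm_or_anticomm R).resolve_left hne
    have h1 : (inner ℂ s (act P.matrix s) : ℂ) = -inner ℂ s (act P.matrix s) := by
      nth_rw 1 [← hfix g hg]
      rw [inner_act_left, hS.conjTranspose hg, ← act_mul, ← neg_neg ((g : Op n) * P.matrix),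
        ← hanti, act_neg, act_mul, hfix g hg, inner_neg_right]
    exact self_eq_neg.mp h1

/-- A Pauli operator commuting with a maximal stabilizer group has the letters of one of
its elements. -/
theorem exists_mem_stabilizer_of_comm (hS : IsWordStabilizer S) (hs : ‖s‖ = 1)
    (hfix : ∀ g ∈ S, act (g : Op n) s = s) (P : Pauli n)
    (hP : ∀ g ∈ S, P.matrix * (g : Op n) = (g : Op n) * P.matrix) :
    ∃ R : Pauli n, R.letter = P.letter ∧ ∃ g ∈ S, (g : Op n) = R.matrix := by
  have := hS.finite
  have := Fintype.ofFinite S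
  have h := congrArg (fun T => (P.matrix * T).trace) (sum_stabilizer hS hs hfix)
  simp only [Finset.mul_sum, Matrix.trace_sum, mul_smul_comm, Matrix.trace_smul,
    trace_mul_ketBra] at h
  -- By the sum formula this is the trace of `P` times the sum of `S`. It is nonzero because `P s`
  -- is a nonzero multiple of `s`, so some product `P g` has nonzero trace and therefore only
  -- identity letters.
  have hne : (2 ^ n : ℂ) • (inner ℂ s (act P.matrix s) : ℂ) ≠ 0 := by
    rw [smul_ne_zero_iff]
    refine ⟨two_pow_ne_zero n, fun h0 => ?_⟩
    have hPs := act_eq_smul_of_comm hS hs hfix _ hP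
    rw [h0, zero_smul] at hPs
    have : s = 0 := by
      rw [← act_one s, ← P.conjTranspose_mul_self, act_mul, hPs, map_zero]
    simp [this] at hs
  rw [← h] at hne
  obtain ⟨g, -, hg⟩ := Finset.exists_ne_zero_of_sum_ne_zero hne
  obtain ⟨R, hR⟩ := hS.pauli g g.2
  refine ⟨R, ?_, g, g.2, hR⟩
  rw [hR, Pauli.matrix_mul] at hg
  ext j
  by_contra hj
  refine hg (Pauli.trace_matrix _ j fun h => hj ?_)
  rw [Letter.mul_eq_I _ _ h]

/-- The states fixed by the stabilizers commuting with `G` are spanned by the images of the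
stabilizer state under `G`. -/
theorem mem_span_of_fixed (hS : IsWordStabilizer S) (hs : ‖s‖ = 1)
    (hfix : ∀ g ∈ S, act (g : Op n) s = s) (G : Subgroup (U n)) [Finite G]
    (hG : ∀ g ∈ G, ∃ P : Pauli n, (g : Op n) = P.matrix) (φ : H n)
    (hφ : ∀ h ∈ S, (∀ g ∈ G, g * h = h * g) → act (h : Op n) φ = φ) :
    φ ∈ Submodule.span ℂ {ψ | ∃ g ∈ G, ψ = act (g : Op n) s} := by
  classical
  have := hS.finite
  have := Fintype.ofFinite S
  have := Fintype.ofFinite G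
  -- Averaging over `G` keeps the stabilizers that commute with `G`. Any other one anticommutes with
  -- some element of `G`, and translating the sum by that element negates it.
  have key : ∀ h : S, ∑ g : G, act (((g : U n) * h * (g : U n)⁻¹ : U n) : Op n) φ =
      if ∀ g ∈ G, g * (h : U n) = h * g then (Fintype.card G : ℂ) • φ else 0 := by
    intro h
    split_ifs with hc
    · rw [Finset.sum_congr rfl fun (g : G) _ => by
        rw [hc g g.2, mul_inv_cancel_right, hφ h h.2 hc], Finset.sum_const, Finset.card_univ,
        ← Nat.cast_smul_eq_nsmul ℂ]
    · push Not at hc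
      obtain ⟨g₀, hg₀, hne⟩ := hc
      obtain ⟨P, hP⟩ := hG g₀ hg₀
      obtain ⟨R, hR⟩ := hS.pauli h h.2
      have hanti : g₀ * (h : U n) * g₀⁻¹ = -h := by
        rw [mul_inv_eq_iff_eq_mul, neg_mul]
        refine Subtype.ext ?_
        have := (P.comm_or_anticomm R).resolve_left (by
          rw [← hP, ← hR]; exact fun h' => hne (Subtype.ext h'))
        rw [coe_neg_unitary, Submonoid.coe_mul, Submonoid.coe_mul, hP, hR]
        exact this
      refine eq_zero_of_eq_neg ?_
      rw [← Finset.sum_neg_distrib]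
      refine (Fintype.sum_equiv (Equiv.mulRight (⟨g₀, hg₀⟩ : G)) _ _ fun g => ?_).symm
      have : ((g : U n) * g₀) * h * ((g : U n) * g₀)⁻¹ = -((g : U n) * h * (g : U n)⁻¹) := by
        rw [mul_inv_rev, ← mul_assoc, mul_assoc (g : U n) g₀, mul_assoc (g : U n) _ g₀⁻¹, hanti]
        simp
      simp only [Equiv.coe_mulRight, Subgroup.coe_mul, this]
      rw [← act_neg]; rfl
  have hsum := Finset.sum_congr rfl fun (h : S) (_ : h ∈ Finset.univ) => key h
  rw [Finset.sum_comm, Finset.sum_ite, Finset.sum_const_zero, add_zero, Finset.sum_const,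
    ← Nat.cast_smul_eq_nsmul ℂ, smul_smul] at hsum
  set C := Finset.univ.filter fun h : S => ∀ g ∈ G, g * (h : U n) = h * g with hC
  have hC0 : (C.card : ℂ) * Fintype.card G ≠ 0 := by
    rw [← Nat.cast_mul, Nat.cast_ne_zero]
    refine mul_ne_zero (Finset.card_ne_zero_of_mem (a := 1) ?_) Fintype.card_ne_zero
    simp [hC]
  have hmem : ((C.card : ℂ) * Fintype.card G) • φ ∈
      Submodule.span ℂ {ψ | ∃ g ∈ G, ψ = act (g : Op n) s} := by
    rw [← hsum]
    refine Submodule.sum_mem _ fun g _ => ?_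
    -- Summed over `S` first, the same double sum becomes a sum of multiples of `g |s⟩⟨s| g⁻¹ φ`,
    -- which lies in the desired span.
    have : ∑ h : S, act (((g : U n) * h * (g : U n)⁻¹ : U n) : Op n) φ =
        act ((g : U n) : Op n) (act (∑ h : S, ((h : U n) : Op n))
          (act (((g : U n)⁻¹ : U n) : Op n) φ)) := by
      rw [act_sum, map_sum]
      refine Finset.sum_congr rfl fun h _ => ?_
      rw [← act_mul, ← act_mul, Submonoid.coe_mul, Submonoid.coe_mul, mul_assoc]
    rw [this, sum_stabilizer hS hs hfix, act_smul, act_ketBra, map_smul, map_smul]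
    exact Submodule.smul_mem _ _ (Submodule.smul_mem _ _ (Submodule.subset_span ⟨g, g.2, rfl⟩))
  exact (Submodule.smul_mem_iff _ hC0).mp hmem

end

/-! ### Running circuits -/

section
variable {ι : Type} [Fintype ι] [DecidableEq ι]

theorem Gate.apply_add (g : Gate ι) (ψ φ : Qubits ι) : g.apply (ψ + φ) = g.apply ψ + g.apply φ := by
  cases g <;> ext x <;> simp [Gate.apply, mul_add, Finset.sum_add_distrib]

theorem Gate.apply_smul (g : Gate ι) (c : ℂ) (ψ : Qubits ι) : g.apply (c • ψ) = c • g.apply ψ := by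
  cases g <;> ext x <;>
    simp only [Gate.apply, PiLp.smul_apply, smul_eq_mul, Finset.mul_sum, mul_left_comm]

@[simp] theorem run_nil (ψ : Qubits ι) : run [] ψ = ψ := rfl

@[simp] theorem run_cons (g : Gate ι) (C : List (Gate ι)) (ψ : Qubits ι) :
    run (g :: C) ψ = run C (g.apply ψ) := rfl

theorem run_append (C D : List (Gate ι)) (ψ : Qubits ι) : run (C ++ D) ψ = run D (run C ψ) := by
  simp [run]

theorem run_add (C : List (Gate ι)) (ψ φ : Qubits ι) : run C (ψ + φ) = run C ψ + run C φ := by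
  induction C generalizing ψ φ with
  | nil => rfl
  | cons g C ih => simp [Gate.apply_add, ih]

theorem run_smul (C : List (Gate ι)) (c : ℂ) (ψ : Qubits ι) : run C (c • ψ) = c • run C ψ := by
  induction C generalizing ψ with
  | nil => rfl
  | cons g C ih => simp [Gate.apply_smul, ih]

/-- The controlled version of a one-qubit unitary; the second qubit is the control. -/
def controlled (v : Matrix.unitaryGroup (Fin 2) ℂ) : Matrix.unitaryGroup (Fin 2 × Fin 2) ℂ :=
  ⟨Matrix.blockDiagonal ![1, (v : Matrix (Fin 2) (Fin 2) ℂ)], by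
    rw [Matrix.mem_unitaryGroup_iff, Matrix.star_eq_conjTranspose,
      Matrix.blockDiagonal_conjTranspose, ← Matrix.blockDiagonal_mul, ← Matrix.blockDiagonal_one]
    congr 1
    ext1 i
    fin_cases i
    · simp
    · exact Matrix.mem_unitaryGroup_iff.mp v.2⟩

theorem apply_controlled (p q : ι) (h : q ≠ p) (v : Matrix.unitaryGroup (Fin 2) ℂ) (ψ : Qubits ι)
    (x : ι → Fin 2) : (Gate.two q p h (controlled v)).apply ψ x =
      if x p = 1 then (Gate.one q v).apply ψ x else ψ x := by
  simp only [Gate.apply, controlled, Fintype.sum_prod_type, Matrix.blockDiagonal_apply, ite_mul,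
    zero_mul, Finset.sum_ite_eq, Finset.mem_univ, if_true]
  have hu : ∀ c, Function.update (Function.update x q c) p (x p) = Function.update x q c := by
    intro c
    have : (Function.update x q c) p = x p := Function.update_of_ne h.symm _ _
    rw [← this, Function.update_eq_self]
  simp only [hu]
  have h2 : ∀ d : Fin 2, d = 0 ∨ d = 1 := by decide
  rcases h2 (x p) with h0 | h1
  · simp [h0, Matrix.one_apply]
  · simp [h1]

/-- A controlled gate acts on a state with definite value `β` of the control. -/
theorem apply_controlled_of_support (p q : ι) (h : q ≠ p) (v : Matrix.unitaryGroup (Fin 2) ℂ)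
    (ψ : Qubits ι) (β : Fin 2) (hψ : ∀ x, x p ≠ β → ψ x = 0) :
    (Gate.two q p h (controlled v)).apply ψ = if β = 1 then (Gate.one q v).apply ψ else ψ := by
  ext x
  rw [apply_controlled]
  by_cases hx : x p = β
  · rw [hx]; split_ifs <;> rfl
  · have h1 : (Gate.one q v).apply ψ x = 0 := by
      simp only [Gate.apply]
      refine Finset.sum_eq_zero fun c _ => ?_
      rw [hψ _ (by rwa [Function.update_of_ne h.symm]), mul_zero]
    split_ifs <;> simp [h1, hψ x hx]

end

/-! ### Gates on data qubits and ancillas -/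

section
variable {n m : ℕ}

theorem withAncillas_add (ψ φ : H n) (b : Fin m → Fin 2) :
    withAncillas (ψ + φ) b = withAncillas ψ b + withAncillas φ b := by
  ext x; simp only [withAncillas, PiLp.add_apply]; split_ifs <;> simp

theorem withAncillas_smul (c : ℂ) (ψ : H n) (b : Fin m → Fin 2) :
    withAncillas (c • ψ) b = c • withAncillas ψ b := by
  ext x; simp only [withAncillas, PiLp.smul_apply]; split_ifs <;> simp

theorem withAncillas_zero (b : Fin m → Fin 2) : withAncillas (0 : H n) b = 0 := by
  ext x; simp [withAncillas]

theorem withAncillas_support (ψ : H n) (b : Fin m → Fin 2) (q : Fin m)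
    (x : Fin n ⊕ Fin m → Fin 2) (h : x (Sum.inr q) ≠ b q) : withAncillas ψ b x = 0 := by
  simp only [withAncillas]
  exact if_neg fun h' => h (congrFun h' q)

theorem apply_one_ancilla (q : Fin m) (v : Matrix.unitaryGroup (Fin 2) ℂ) (φ : H n)
    (b : Fin m → Fin 2) : (Gate.one (Sum.inr q) v).apply (withAncillas φ b) =
      ∑ c, (v : Matrix (Fin 2) (Fin 2) ℂ) c (b q) • withAncillas φ (Function.update b q c) := by
  ext x
  have hr : ∀ c, ((fun j => x (Sum.inr j)) = Function.update b q c) ↔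
      (∀ j, j ≠ q → x (Sum.inr j) = b j) ∧ x (Sum.inr q) = c := by
    intro c
    rw [funext_iff]
    constructor
    · exact fun h => ⟨fun j hj => by simpa [hj] using h j, by simpa using h q⟩
    · rintro ⟨h1, h2⟩ j
      by_cases hj : j = q
      · subst hj; simpa using h2
      · simpa [hj] using h1 j hj
  have hl : ∀ c, ((fun j => Function.update x (Sum.inr q) c (Sum.inr j)) = b) ↔
      (∀ j, j ≠ q → x (Sum.inr j) = b j) ∧ b q = c := by
    intro c
    rw [funext_iff]
    constructor
    · exact fun h => ⟨fun j hj => by simpa [hj] using h j, by simpa using (h q).symm⟩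
    · rintro ⟨h1, h2⟩ j
      by_cases hj : j = q
      · subst hj; simpa using h2.symm
      · simpa [hj] using h1 j hj
  classical
  generalize (∀ j, j ≠ q → x (Sum.inr j) = b j) = p at hr hl
  simp only [Gate.apply, withAncillas, hl, WithLp.ofLp_sum, Finset.sum_apply, PiLp.smul_apply, hr]
  by_cases hp : p <;> simp [hp]

/-- A one-qubit operator applied to qubit `i`. -/
def onQubit (i : Fin n) (v : Matrix (Fin 2) (Fin 2) ℂ) : Op n :=
  tens fun j => if j = i then v else 1

theorem act_onQubit (i : Fin n) (v : Matrix (Fin 2) (Fin 2) ℂ) (φ : H n) (x : Fin n → Fin 2) :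
    act (onQubit i v) φ x = ∑ c, v (x i) c * φ (Function.update x i c) := by
  rw [act_apply]
  symm
  refine Finset.sum_of_injOn (fun c => Function.update x i c)
    (fun c _ d _ h => by simpa using congrFun h i) (by simp) ?_ ?_
  · intro y _ hy
    obtain ⟨j, hj, hne⟩ : ∃ j, j ≠ i ∧ x j ≠ y j := by
      by_contra! h
      refine hy ⟨y i, by simp, ?_⟩
      ext1 j
      by_cases hj : j = i
      · subst hj; simp
      · simp [hj, h j hj]
    rw [onQubit, tens, Matrix.of_apply, Finset.prod_eq_zero (Finset.mem_univ j), zero_mul]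
    simp [hj, hne]
  · intro c _
    rw [onQubit, tens, Matrix.of_apply, Finset.prod_eq_single i]
    · simp
    · intro j _ hj; simp [hj, Matrix.one_apply]
    · simp

theorem apply_one_data (i : Fin n) (v : Matrix.unitaryGroup (Fin 2) ℂ) (φ : H n)
    (b : Fin m → Fin 2) : (Gate.one (Sum.inl i) v).apply (withAncillas φ b) =
      withAncillas (act (onQubit i v) φ) b := by
  ext x
  simp only [Gate.apply, withAncillas]
  split_ifs with h
  · rw [act_onQubit]
    refine Finset.sum_congr rfl fun c _ => ?_
    have hu : (fun j => Function.update x (Sum.inl i) c (Sum.inl j)) =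
        Function.update (fun j => x (Sum.inl j)) i c := by
      funext j
      by_cases hj : j = i
      · subst hj; simp
      · simp [hj]
    rw [if_pos (by simpa using h), hu]
  · refine Finset.sum_eq_zero fun c _ => ?_
    rw [if_neg (by simpa using h), mul_zero]

theorem Letter.mem_unitaryGroup (a : Letter) : a.matrix ∈ Matrix.unitaryGroup (Fin 2) ℂ := by
  rw [Matrix.mem_unitaryGroup_iff, Matrix.star_eq_conjTranspose, Letter.matrix_conjTranspose,
    Letter.matrix_mul_self]

/-- The controlled letters of a Pauli operator on a list of data qubits. -/
def controlledLetters (P : Pauli n) (c : Fin m) (l : List (Fin n)) : List (Gate (Fin n ⊕ Fin m)) :=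
  l.map fun i => Gate.two (Sum.inl i) (Sum.inr c) Sum.inl_ne_inr
    (controlled ⟨(P.letter i).matrix, (P.letter i).mem_unitaryGroup⟩)

theorem run_controlledLetters (P : Pauli n) (c : Fin m) (l : List (Fin n)) (hl : l.Nodup) (φ : H n)
    (b : Fin m → Fin 2) : run (controlledLetters P c l) (withAncillas φ b) =
      if b c = 1 then
        withAncillas (act (tens fun j => if j ∈ l then (P.letter j).matrix else 1) φ) b
      else withAncillas φ b := by
  induction l generalizing φ with
  | nil => simp [controlledLetters, tens_one]
  | cons i l ih =>
    have ih' := ih (List.nodup_cons.mp hl).2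
    have hi := (List.nodup_cons.mp hl).1
    simp only [controlledLetters, List.map_cons, run_cons] at ih' ⊢
    rw [apply_controlled_of_support _ _ _ _ _ (b c) fun x hx => withAncillas_support φ b c x hx]
    split_ifs with h
    · rw [apply_one_data, ih', if_pos h, ← act_mul, onQubit, tens_mul]
      congr 4
      ext1 j
      by_cases hj : j = i
      · subst hj; simp [hi]
      · simp [hj]
    · rw [ih', if_neg h]

/-- The phase gate with phase `i ^ k`. -/
def phaseGate (k : ℕ) : Matrix.unitaryGroup (Fin 2) ℂ :=
  ⟨Matrix.diagonal ![1, Complex.I ^ k], by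
    rw [Matrix.mem_unitaryGroup_iff, Matrix.star_eq_conjTranspose, Matrix.diagonal_conjTranspose,
      Matrix.diagonal_mul_diagonal, ← Matrix.diagonal_one]
    congr 1
    ext1 i
    fin_cases i
    · simp
    · simpa [mul_comm] using Pauli.norm_I_pow k⟩

/-- The Pauli operator `P` controlled by the ancilla `c`. -/
def controlledPauli (P : Pauli n) (c : Fin m) : List (Gate (Fin n ⊕ Fin m)) :=
  Gate.one (Sum.inr c) (phaseGate P.phase) :: controlledLetters P c P.support.toList

/-- The phase of `P` is placed on the control by a one-qubit gate, so the two-qubit gates only have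
to supply the letters and number exactly the weight of `P`. -/
theorem run_controlledPauli (P : Pauli n) (c : Fin m) (φ : H n) (b : Fin m → Fin 2) :
    run (controlledPauli P c) (withAncillas φ b) =
      if b c = 1 then withAncillas (act P.matrix φ) b else withAncillas φ b := by
  have h2 : ∀ d : Fin 2, d = 0 ∨ d = 1 := by decide
  have hP : (tens fun j => if j ∈ P.support.toList then (P.letter j).matrix else 1) =
      tens fun j => (P.letter j).matrix := by
    congr 1; ext1 j
    by_cases hj : P.letter j = Letter.I
    · simp [Pauli.support, hj, Letter.matrix]
    · simp [Pauli.support, hj]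
  rw [controlledPauli, run_cons, apply_one_ancilla]
  rcases h2 (b c) with h | h
  · have : Function.update b c 0 = b := by rw [← h, Function.update_eq_self]
    simp [h, phaseGate, this, run_controlledLetters _ _ _ (Finset.nodup_toList _)]
  · have : Function.update b c 1 = b := by rw [← h, Function.update_eq_self]
    simp [h, phaseGate, this, run_smul, run_controlledLetters _ _ _ (Finset.nodup_toList _), ← hP,
      Pauli.matrix_eq, withAncillas_smul]

theorem twoQubitGates_append {ι : Type} (C D : List (Gate ι)) :
    twoQubitGates (C ++ D) = twoQubitGates C + twoQubitGates D := List.countP_append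

theorem twoQubitGates_controlledPauli (P : Pauli n) (c : Fin m) :
    twoQubitGates (controlledPauli P c) = P.weight := by
  have : ∀ l : List (Fin n), twoQubitGates (controlledLetters P c l) = l.length := by
    intro l
    rw [twoQubitGates, controlledLetters, List.countP_map, List.countP_eq_length.mpr]
    intro i _; rfl
  have h := this P.support.toList
  rw [Finset.length_toList] at h
  rw [controlledPauli]
  exact (List.countP_cons_of_neg (by simp [Gate.isTwo])).trans h

/-- A one-qubit gate on the ancilla `c`, controlled by the ancilla `q` if there is one. -/
def ancillaGate (q : Option (Fin m)) (c : Fin m) (v : Matrix.unitaryGroup (Fin 2) ℂ) :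
    List (Gate (Fin n ⊕ Fin m)) :=
  match q with
  | none => [Gate.one (Sum.inr c) v]
  -- A two-qubit gate needs distinct qubits; the empty circuit only fills the case `c = q`.
  | some q => if h : c = q then [] else
      [Gate.two (Sum.inr c) (Sum.inr q) (fun h' => h (Sum.inr_injective h')) (controlled v)]

theorem run_ancillaGate_on (q : Option (Fin m)) (c : Fin m) (v : Matrix.unitaryGroup (Fin 2) ℂ)
    (φ : H n) (b : Fin m → Fin 2) (hqc : q ≠ some c) (hq : ∀ p, q = some p → b p = 1) :
    run (ancillaGate q c v) (withAncillas φ b) =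
      ∑ d, (v : Matrix (Fin 2) (Fin 2) ℂ) d (b c) • withAncillas φ (Function.update b c d) := by
  rw [← apply_one_ancilla]
  cases q with
  | none => rfl
  | some q =>
    have h : c ≠ q := fun h => hqc (by rw [h])
    simp only [ancillaGate, dif_neg h, run_cons, run_nil]
    rw [apply_controlled_of_support _ _ _ _ _ (b q) fun x hx => withAncillas_support φ b q x hx,
      if_pos (hq q rfl)]

theorem run_ancillaGate_off (q c : Fin m) (v : Matrix.unitaryGroup (Fin 2) ℂ)
    (φ : H n) (b : Fin m → Fin 2) (hq : b q = 0) :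
    run (ancillaGate (some q) c v) (withAncillas φ b) = withAncillas φ b := by
  by_cases h : c = q
  · simp [ancillaGate, h]
  · simp only [ancillaGate, dif_neg h, run_cons, run_nil]
    rw [apply_controlled_of_support _ _ _ _ _ (b q) fun x hx => withAncillas_support φ b q x hx,
      if_neg (by simp [hq])]

theorem twoQubitGates_ancillaGate_none (c : Fin m) (v : Matrix.unitaryGroup (Fin 2) ℂ) :
    twoQubitGates (ancillaGate (n := n) none c v) = 0 := rfl

theorem twoQubitGates_ancillaGate_some (q c : Fin m) (v : Matrix.unitaryGroup (Fin 2) ℂ) :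
    twoQubitGates (ancillaGate (n := n) (some q) c v) ≤ 1 := by
  simp only [ancillaGate]
  split_ifs
  · exact Nat.zero_le _
  · exact List.countP_le_length

theorem inv_sqrt_two_mul_self : ((Real.sqrt 2 : ℂ))⁻¹ * ((Real.sqrt 2 : ℂ))⁻¹ = (1 / 2 : ℂ) := by
  rw [← mul_inv, ← Complex.ofReal_mul, Real.mul_self_sqrt (by norm_num)]; norm_num

/-- The Hadamard gate. -/
def hadamard : Matrix.unitaryGroup (Fin 2) ℂ :=
  ⟨((Real.sqrt 2 : ℂ))⁻¹ • !![1, 1; 1, -1], by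
    have hc : (!![1, 1; 1, -1] : Matrix (Fin 2) (Fin 2) ℂ).conjTranspose = !![1, 1; 1, -1] := by
      ext i j; fin_cases i <;> fin_cases j <;> simp [Matrix.conjTranspose_apply]
    rw [Matrix.mem_unitaryGroup_iff, star_smul, smul_mul_smul_comm, Matrix.star_eq_conjTranspose,
      hc]
    simp only [star_inv₀, Complex.star_def, Complex.conj_ofReal, inv_sqrt_two_mul_self]
    ext i j
    fin_cases i <;> fin_cases j <;> simp <;> norm_num⟩

/-- The bit flip. -/
def flipGate : Matrix.unitaryGroup (Fin 2) ℂ := ⟨Letter.X.matrix, Letter.X.mem_unitaryGroup⟩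

end

/-! ### Coherent measurement of a joint eigenspace of Pauli operators -/

section
variable {n m : ℕ}

theorem withAncillas_sub (ψ φ : H n) (b : Fin m → Fin 2) :
    withAncillas (ψ - φ) b = withAncillas ψ b - withAncillas φ b := by
  rw [sub_eq_add_neg, ← neg_one_smul ℂ, withAncillas_add, withAncillas_smul, neg_one_smul,
    ← sub_eq_add_neg]

/-- The operator `(1 - P) / 2`. -/
def minusProj (P : Pauli n) : H n →ₗ[ℂ] H n := (1 / 2 : ℂ) • (LinearMap.id - act P.matrix)

theorem minusProj_apply (P : Pauli n) (φ : H n) :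
    minusProj P φ = (1 / 2 : ℂ) • (φ - act P.matrix φ) := rfl

/-- The product of the operators `(1 - P) / 2` for `P` in a list. -/
def jointProj : List (Pauli n) → H n →ₗ[ℂ] H n
  | [] => LinearMap.id
  | P :: l => jointProj l ∘ₗ minusProj P

@[simp] theorem jointProj_nil (φ : H n) : jointProj [] φ = φ := rfl

@[simp] theorem jointProj_cons (P : Pauli n) (l : List (Pauli n)) (φ : H n) :
    jointProj (P :: l) φ = jointProj l (minusProj P φ) := rfl

theorem act_jointProj_comm (P : Pauli n) (l : List (Pauli n))
    (h : ∀ R ∈ l, P.matrix * R.matrix = R.matrix * P.matrix) (φ : H n) :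
    act P.matrix (jointProj l φ) = jointProj l (act P.matrix φ) := by
  induction l generalizing φ with
  | nil => rfl
  | cons R l ih =>
    rw [jointProj_cons, jointProj_cons, ih fun R hR => h R (List.mem_cons_of_mem _ hR)]
    congr 1
    rw [minusProj_apply, minusProj_apply, map_smul, map_sub, ← act_mul, ← act_mul,
      h R List.mem_cons_self]

/-- If the control `q` is on, the ancilla `c` is flipped on the eigenspace of `P` with
eigenvalue `-1`. -/
def stage (q : Option (Fin m)) (P : Pauli n) (c : Fin m) : List (Gate (Fin n ⊕ Fin m)) :=
  ancillaGate q c hadamard ++ (controlledPauli P c ++ ancillaGate q c hadamard)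

/-- Only the Hadamard gates are controlled by `q`. With `q` off, `c` remains 0 and the controlled
Pauli is inert, so no gate with two controls is needed. -/
theorem run_stage_off (q c : Fin m) (P : Pauli n) (φ : H n) (b : Fin m → Fin 2) (hq : b q = 0)
    (hc : b c = 0) : run (stage (some q) P c) (withAncillas φ b) = withAncillas φ b := by
  rw [stage, run_append, run_append, run_ancillaGate_off _ _ _ _ _ hq, run_controlledPauli,
    if_neg (by simp [hc]), run_ancillaGate_off _ _ _ _ _ hq]

theorem run_hadamard_on (q : Option (Fin m)) (c : Fin m) (φ : H n) (b : Fin m → Fin 2)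
    (hqc : q ≠ some c) (hq : ∀ p, q = some p → b p = 1) (d : Fin 2) :
    run (ancillaGate q c hadamard) (withAncillas φ (Function.update b c d)) =
      ((Real.sqrt 2 : ℂ))⁻¹ • (withAncillas φ (Function.update b c 0) +
        (if d = 1 then (-1 : ℂ) else 1) • withAncillas φ (Function.update b c 1)) := by
  rw [run_ancillaGate_on _ _ _ _ _ hqc]
  · have h2 : ∀ d : Fin 2, d = 0 ∨ d = 1 := by decide
    rcases h2 d with rfl | rfl <;> simp [hadamard, smul_add, -Complex.ofReal_inv]
  · intro p hp
    rw [Function.update_of_ne, hq p hp]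
    rintro rfl; exact hqc hp

/-- This is the Hadamard test. Both initial values of `c` matter: 0 when the eigenvalue is recorded,
1 when the record is erased. -/
theorem run_stage_on (q : Option (Fin m)) (P : Pauli n) (c : Fin m) (φ : H n) (b : Fin m → Fin 2)
    (hqc : q ≠ some c) (hq : ∀ p, q = some p → b p = 1) :
    run (stage q P c) (withAncillas φ (Function.update b c 0)) =
        withAncillas (minusProj P φ) (Function.update b c 1) +
          withAncillas (φ - minusProj P φ) (Function.update b c 0) ∧
    run (stage q P c) (withAncillas φ (Function.update b c 1)) =
        withAncillas (minusProj P φ) (Function.update b c 0) +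
          withAncillas (φ - minusProj P φ) (Function.update b c 1) := by
  have hr := inv_sqrt_two_mul_self
  simp only [stage, run_append, run_hadamard_on q c _ b hqc hq, run_smul, run_add,
    run_controlledPauli, Function.update_self, minusProj_apply, withAncillas_sub,
    withAncillas_smul, zero_ne_one, if_true, if_false]
  constructor
  -- The two Hadamard normalizations multiply to 1/2; apart from that the identity is linear in the
  -- four vectors.
  · linear_combination (norm := module) hr •
      (withAncillas φ (Function.update b c 0) + withAncillas φ (Function.update b c 1) +
        withAncillas (act P.matrix φ) (Function.update b c 0) -
        withAncillas (act P.matrix φ) (Function.update b c 1))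
  · linear_combination (norm := module) hr •
      (withAncillas φ (Function.update b c 0) + withAncillas φ (Function.update b c 1) -
        withAncillas (act P.matrix φ) (Function.update b c 0) +
        withAncillas (act P.matrix φ) (Function.update b c 1))

/-- The ancilla `0` is flipped if all operators of the list have eigenvalue `-1` and the control
`q` is on. -/
def flipIf {a : ℕ} : Option (Fin (a + 1)) → List (Pauli n × Fin (a + 1)) →
    List (Gate (Fin n ⊕ Fin (a + 1)))
  | q, [] => ancillaGate q 0 flipGate
  -- The second stage erases the record in `c`, so that the work ancillas can be reused.
  | q, (P, c) :: l => stage q P c ++ (flipIf (some c) l ++ stage q P c)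

theorem run_flipIf_off {a : ℕ} (q : Fin (a + 1)) (l : List (Pauli n × Fin (a + 1)))
    (φ : H n) (b : Fin (a + 1) → Fin 2) (hq : b q = 0) (hl : ∀ x ∈ l, b x.2 = 0) :
    run (flipIf (some q) l) (withAncillas φ b) = withAncillas φ b := by
  induction l generalizing q with
  | nil => exact run_ancillaGate_off _ _ _ _ _ hq
  | cons x l ih =>
    obtain ⟨P, c⟩ := x
    have hc : b c = 0 := hl _ List.mem_cons_self
    rw [flipIf, run_append, run_append, run_stage_off _ _ _ _ _ hq hc,
      ih c hc fun x hx => hl x (List.mem_cons_of_mem _ hx), run_stage_off _ _ _ _ _ hq hc]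

/-- The first stage splits `φ` into the -1 part of `P`, with `c` on, and the rest, with `c` off; the
inner circuit sees only the former. As the operators commute, the inner circuit leaves `c`
correlated with the eigenvalue of `P`, and the second stage resets it. The value `b 0` is kept
general because the readout may already be flipped. -/
theorem run_flipIf_on {a : ℕ} (q : Option (Fin (a + 1))) (l : List (Pauli n × Fin (a + 1)))
    (φ : H n) (b : Fin (a + 1) → Fin 2) (hq : ∀ p, q = some p → b p = 1) (hq0 : q ≠ some 0)
    (hql : ∀ x ∈ l, q ≠ some x.2) (hl0 : ∀ x ∈ l, x.2 ≠ 0) (hlb : ∀ x ∈ l, b x.2 = 0)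
    (hnd : (l.map Prod.snd).Nodup) (hinv : ∀ x ∈ l, x.1.matrix * x.1.matrix = 1)
    (hcomm : ∀ x ∈ l, ∀ y ∈ l, x.1.matrix * y.1.matrix = y.1.matrix * x.1.matrix) :
    run (flipIf q l) (withAncillas φ b) =
      withAncillas (jointProj (l.map Prod.fst) φ) (Function.update b 0 (b 0 + 1)) +
        withAncillas (φ - jointProj (l.map Prod.fst) φ) b := by
  induction l generalizing q φ b with
  | nil =>
    rw [flipIf, run_ancillaGate_on _ _ _ _ _ hq0 hq]
    have h2 : ∀ d : Fin 2, d = 0 ∨ d = 1 := by decide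
    rcases h2 (b 0) with h | h <;> simp [h, flipGate, Letter.matrix, withAncillas_zero]
  | cons x l ih =>
    obtain ⟨P, c⟩ := x
    have hc : b c = 0 := hlb (P, c) List.mem_cons_self
    have hc0 : c ≠ 0 := hl0 (P, c) List.mem_cons_self
    have hqc : q ≠ some c := hql (P, c) List.mem_cons_self
    have hP : P.matrix * P.matrix = 1 := hinv (P, c) List.mem_cons_self
    have hne : ∀ x ∈ l, x.2 ≠ c := fun x hx h =>
      (List.nodup_cons.mp hnd).1 (List.mem_map.mpr ⟨x, hx, h⟩)
    have hb : b = Function.update b c 0 := by rw [← hc, Function.update_eq_self]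
    have h1 := (run_stage_on q P c φ b hqc hq).1
    rw [← hb] at h1
    have hoff : ∀ χ, run (flipIf (some c) l) (withAncillas χ b) = withAncillas χ b := fun χ =>
      run_flipIf_off c l χ b hc fun x hx => hlb x (List.mem_cons_of_mem _ hx)
    have hon := ih (some c) (minusProj P φ) (Function.update b c 1)
      (by rintro p ⟨⟩; simp) (by simpa using hc0)
      (fun x hx => by simpa using (hne x hx).symm)
      (fun x hx => hl0 x (List.mem_cons_of_mem _ hx))
      (fun x hx => by
        rw [Function.update_of_ne (hne x hx)]; exact hlb x (List.mem_cons_of_mem _ hx))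
      (List.nodup_cons.mp hnd).2 (fun x hx => hinv x (List.mem_cons_of_mem _ hx))
      (fun x hx y hy => hcomm x (List.mem_cons_of_mem _ hx) y (List.mem_cons_of_mem _ hy))
    rw [Function.update_of_ne hc0.symm, Function.update_comm hc0] at hon
    have hPl : ∀ R ∈ l.map Prod.fst, P.matrix * R.matrix = R.matrix * P.matrix := by
      intro R hR
      obtain ⟨x, hx, rfl⟩ := List.mem_map.mp hR
      exact hcomm (P, c) List.mem_cons_self x (List.mem_cons_of_mem _ hx)
    obtain ⟨J, hJ⟩ : ∃ J, J = jointProj (l.map Prod.fst) := ⟨_, rfl⟩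
    have hPJ := act_jointProj_comm P _ hPl
    rw [← hJ] at hon hPJ
    have hidem : ∀ χ, minusProj P (minusProj P χ) = minusProj P χ := by
      intro χ
      simp only [minusProj_apply, map_smul, map_sub, ← act_mul, hP, act_one]
      module
    -- The accepted component still has eigenvalue -1 for `P`, which lets the second stage erase
    -- `c`.
    have hfix : minusProj P (J (minusProj P φ)) = J (minusProj P φ) := by
      conv_lhs => rw [minusProj_apply, hPJ, ← map_sub, ← map_smul,
        ← minusProj_apply, hidem]
    obtain ⟨b', hb'⟩ : ∃ b', b' = Function.update b 0 (b 0 + 1) := ⟨_, rfl⟩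
    rw [← hb'] at hon
    have hq' : ∀ p, q = some p → b' p = 1 := by
      intro p hp
      rw [hb', Function.update_of_ne, hq p hp]
      rintro rfl; exact hq0 hp
    have hbc' : b' = Function.update b' c 0 := by
      have : b' c = 0 := by rw [hb', Function.update_of_ne hc0, hc]
      rw [← this, Function.update_eq_self]
    -- The three components before erasure: accepted; -1 for `P` but rejected later; rejected by
    -- `P`.
    have h3 := (run_stage_on q P c (J (minusProj P φ)) b' hqc hq').2
    have h4 := (run_stage_on q P c (minusProj P φ - J (minusProj P φ)) b hqc hq).2
    have h5 := (run_stage_on q P c (φ - minusProj P φ) b hqc hq).1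
    rw [map_sub, hidem, hfix] at h4
    rw [map_sub, hidem] at h5
    rw [hfix] at h3
    rw [← hbc'] at h3
    rw [← hb] at h4 h5
    rw [← hb', flipIf, run_append, run_append, h1, run_add, hoff, hon, run_add, run_add, h3, h4, h5]
    simp only [List.map_cons, jointProj_cons, ← hJ, sub_self, withAncillas_zero, add_zero, zero_add]
    rw [add_assoc, ← withAncillas_add]
    congr 2
    abel

theorem twoQubitGates_stage_none (P : Pauli n) (c : Fin m) :
    twoQubitGates (stage none P c) = P.weight := by
  rw [stage, twoQubitGates_append, twoQubitGates_append, twoQubitGates_controlledPauli,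
    twoQubitGates_ancillaGate_none]
  simp

theorem twoQubitGates_stage_some (q c : Fin m) (P : Pauli n) :
    twoQubitGates (stage (some q) P c) ≤ P.weight + 2 := by
  rw [stage, twoQubitGates_append, twoQubitGates_append, twoQubitGates_controlledPauli]
  have := twoQubitGates_ancillaGate_some (n := n) q c hadamard
  omega

/-- Each operator is tested and untested, at the cost of its weight plus two controlled Hadamard
gates each time; the final controlled flip adds 1. -/
theorem twoQubitGates_flipIf_some {a : ℕ} (w : ℕ) (q : Fin (a + 1))
    (l : List (Pauli n × Fin (a + 1))) (hw : ∀ x ∈ l, x.1.weight ≤ w) :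
    twoQubitGates (flipIf (some q) l) ≤ 2 * l.length * (w + 2) + 1 := by
  induction l generalizing q with
  | nil => simpa [flipIf] using twoQubitGates_ancillaGate_some (n := n) q 0 flipGate
  | cons x l ih =>
    obtain ⟨P, c⟩ := x
    have h1 := ih c fun x hx => hw x (List.mem_cons_of_mem _ hx)
    have h2 := twoQubitGates_stage_some q c P
    have h3 : P.weight ≤ w := hw (P, c) List.mem_cons_self
    rw [flipIf, twoQubitGates_append, twoQubitGates_append, List.length_cons]
    have : 2 * (l.length + 1) * (w + 2) = 2 * l.length * (w + 2) + 2 * (w + 2) := by ring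
    omega

end

/-! ### Measuring an orthogonal sum of joint eigenspaces -/

section
variable {n : ℕ}

theorem inner_minusProj (P : Pauli n) (hP : P.matrix * P.matrix = 1) (φ ψ : H n)
    (hφ : act P.matrix φ = -φ) : (inner ℂ φ (minusProj P ψ) : ℂ) = inner ℂ φ ψ := by
  have hc : P.matrix.conjTranspose = P.matrix := by
    rw [← mul_one P.matrix.conjTranspose, ← hP, ← mul_assoc, P.conjTranspose_mul_self, one_mul]
  rw [minusProj_apply, inner_smul_right, inner_sub_right, inner_act_right, hc, hφ, inner_neg_left]
  ring

/-- Each factor is self-adjoint and fixes `φ`. With `jointProj_mem` this makes `jointProj l` the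
orthogonal projector for commuting involutions. -/
theorem inner_jointProj (l : List (Pauli n)) (hl : ∀ P ∈ l, P.matrix * P.matrix = 1) (φ ψ : H n)
    (hφ : ∀ P ∈ l, act P.matrix φ = -φ) : (inner ℂ φ (jointProj l ψ) : ℂ) = inner ℂ φ ψ := by
  induction l generalizing ψ with
  | nil => rfl
  | cons P l ih =>
    rw [jointProj_cons, ih (fun R hR => hl R (List.mem_cons_of_mem _ hR)) _
      fun R hR => hφ R (List.mem_cons_of_mem _ hR),
      inner_minusProj P (hl P List.mem_cons_self) _ _ (hφ P List.mem_cons_self)]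

theorem jointProj_mem (l : List (Pauli n)) (hl : ∀ P ∈ l, P.matrix * P.matrix = 1)
    (hcomm : ∀ P ∈ l, ∀ R ∈ l, P.matrix * R.matrix = R.matrix * P.matrix) (ψ : H n) :
    ∀ P ∈ l, act P.matrix (jointProj l ψ) = -jointProj l ψ := by
  induction l generalizing ψ with
  | nil => simp
  | cons P l ih =>
    intro R hR
    rcases List.mem_cons.mp hR with rfl | hR'
    · rw [jointProj_cons, act_jointProj_comm _ _ fun Q hQ =>
        hcomm R List.mem_cons_self Q (List.mem_cons_of_mem _ hQ), ← map_neg]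
      congr 1
      rw [minusProj_apply, map_smul, map_sub, ← act_mul, hl R List.mem_cons_self, act_one]
      module
    · exact ih (fun Q hQ => hl Q (List.mem_cons_of_mem _ hQ))
        (fun Q hQ Q' hQ' => hcomm Q (List.mem_cons_of_mem _ hQ) Q' (List.mem_cons_of_mem _ hQ'))
        _ R hR'

/-- The conditions under which a list of Pauli operators defines a joint eigenspace. -/
structure IsInvolutive (l : List (Pauli n)) : Prop where
  sq : ∀ P ∈ l, P.matrix * P.matrix = 1
  comm : ∀ P ∈ l, ∀ R ∈ l, P.matrix * R.matrix = R.matrix * P.matrix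

/-- The vector has eigenvalue -1 for `P` by the outer projector, and +1 by the inner one, since `P`
commutes with the outer projector. -/
theorem jointProj_jointProj_eq_zero {l l' : List (Pauli n)} (hl : IsInvolutive l)
    (hl' : IsInvolutive l') (P P' : Pauli n) (hP : P ∈ l) (hP' : P' ∈ l')
    (h : P'.matrix = -P.matrix) (φ : H n) : jointProj l (jointProj l' φ) = 0 := by
  have h1 := jointProj_mem l' hl'.sq hl'.comm φ P' hP'
  rw [h, act_neg, neg_inj] at h1
  have h2 := jointProj_mem l hl.sq hl.comm (jointProj l' φ) P hP
  rw [act_jointProj_comm P l (hl.comm P hP), h1] at h2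
  exact eq_zero_of_eq_neg h2

/-- All blocks flip the same readout ancilla. By orthogonality a component accepted by one block is
annihilated by the later projectors, so it is never flipped back; `hψ₁` carries this through the
induction. -/
theorem run_flatMap_flipIf {a : ℕ} (cs : List (Fin (a + 1))) (hcs : cs.Nodup) (h0 : 0 ∉ cs)
    (Ls : List (List (Pauli n))) (hlen : ∀ l ∈ Ls, l.length = cs.length)
    (hLs : ∀ l ∈ Ls, IsInvolutive l)
    (horth : Ls.Pairwise fun l l' => ∀ φ, jointProj l' (jointProj l φ) = 0) (ψ₁ ψ₀ : H n)
    (hψ₁ : ∀ l ∈ Ls, jointProj l ψ₁ = 0) :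
    run (Ls.flatMap fun l => flipIf none (l.zip cs))
        (withAncillas ψ₁ (Pi.single 0 1) + withAncillas ψ₀ 0) =
      withAncillas (ψ₁ + (Ls.map fun l => jointProj l ψ₀).sum) (Pi.single 0 1) +
        withAncillas (ψ₀ - (Ls.map fun l => jointProj l ψ₀).sum) 0 := by
  induction Ls generalizing ψ₁ ψ₀ with
  | nil => simp
  | cons l Ls ih =>
    have hl := hLs l List.mem_cons_self
    have hll := hlen l List.mem_cons_self
    have hmem : ∀ x ∈ l.zip cs, x.1 ∈ l ∧ x.2 ∈ cs := fun x hx => List.of_mem_zip hx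
    have hne0 : ∀ x ∈ l.zip cs, x.2 ≠ 0 := fun x hx h => h0 (h ▸ (hmem x hx).2)
    have hrun : ∀ (φ : H n) (b : Fin (a + 1) → Fin 2), (∀ c, c ≠ 0 → b c = 0) →
        run (flipIf none (l.zip cs)) (withAncillas φ b) =
          withAncillas (jointProj l φ) (Function.update b 0 (b 0 + 1)) +
            withAncillas (φ - jointProj l φ) b := by
      intro φ b hb
      have h := run_flipIf_on none (l.zip cs) φ b (by simp) (by simp) (by simp) hne0
        (fun x hx => hb _ (hne0 x hx)) (by rwa [List.map_snd_zip hll.ge])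
        (fun x hx => hl.sq _ (hmem x hx).1)
        (fun x hx y hy => hl.comm _ (hmem x hx).1 _ (hmem y hy).1)
      rwa [List.map_fst_zip hll.le] at h
    have hr1 := hrun ψ₁ (Pi.single 0 1) (by simp +contextual)
    have hr0 := hrun ψ₀ 0 (by simp)
    rw [hψ₁ l List.mem_cons_self, withAncillas_zero, zero_add, sub_zero] at hr1
    have hs : Function.update (0 : Fin (a + 1) → Fin 2) 0 ((0 : Fin (a + 1) → Fin 2) 0 + 1) =
        Pi.single 0 1 := rfl
    rw [hs] at hr0
    have horth' := (List.pairwise_cons.mp horth).1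
    rw [List.flatMap_cons, run_append, run_add, hr1, hr0, ← add_assoc, ← withAncillas_add,
      ih (fun l hl => hlen l (List.mem_cons_of_mem _ hl))
        (fun l hl => hLs l (List.mem_cons_of_mem _ hl)) (List.pairwise_cons.mp horth).2]
    -- Removing the accepted component does not change the later projections.
    · have hm : (Ls.map fun l' => jointProj l' (ψ₀ - jointProj l ψ₀)) =
          Ls.map fun l' => jointProj l' ψ₀ := by
        refine List.map_congr_left fun l' hl' => ?_
        rw [map_sub, horth' l' hl', sub_zero]
      rw [hm, List.map_cons, List.sum_cons, add_assoc, sub_sub]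
    · intro l' hl'
      rw [map_add, hψ₁ l' (List.mem_cons_of_mem _ hl'), horth' l' hl', add_zero]

/-- The orthogonal projector onto an orthogonal sum of joint eigenspaces. -/
theorem starProjection_eq_sum_jointProj (B : Finset (List (Pauli n)))
    (hB : ∀ l ∈ B, IsInvolutive l)
    (horth : ∀ l ∈ B, ∀ l' ∈ B, l ≠ l' → ∀ φ, jointProj l (jointProj l' φ) = 0)
    (V : Submodule ℂ (H n))
    (hV : V = Submodule.span ℂ {φ | ∃ l ∈ B, ∀ P ∈ l, act P.matrix φ = -φ}) (ψ : H n) :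
    V.starProjection ψ = ∑ l ∈ B, jointProj l ψ := by
  symm
  refine (Submodule.eq_starProjection_of_mem_orthogonal ?_ ?_).symm
  · rw [hV]
    exact Submodule.sum_mem _ fun l hl => Submodule.subset_span
      ⟨l, hl, jointProj_mem l (hB l hl).sq (hB l hl).comm ψ⟩
  · rw [hV, Submodule.mem_orthogonal]
    intro φ hφ
    induction hφ using Submodule.span_induction with
    | zero => simp
    | add x y _ _ hx hy => rw [inner_add_left, hx, hy, add_zero]
    | smul c x _ hx => rw [inner_smul_left, hx, mul_zero]
    | mem φ hφ =>
      obtain ⟨l, hl, hφ⟩ := hφ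
      rw [inner_sub_right, inner_sum, Finset.sum_eq_single l,
        inner_jointProj l (hB l hl).sq φ ψ hφ, sub_self]
      · intro l' hl' hne
        rw [← inner_jointProj l (hB l hl).sq φ _ hφ, horth l hl l' hl' hne.symm, inner_zero_right]
      · exact fun h => absurd hl h

/-- One conditional flip is made for each eigenspace, with the same work ancillas every time. -/
theorem measurableWith_of_jointProj (B : Finset (List (Pauli n)))
    (hB : ∀ l ∈ B, IsInvolutive l)
    (horth : ∀ l ∈ B, ∀ l' ∈ B, l ≠ l' → ∀ φ, jointProj l (jointProj l' φ) = 0)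
    (V : Submodule ℂ (H n))
    (hV : V = Submodule.span ℂ {φ | ∃ l ∈ B, ∀ P ∈ l, act P.matrix φ = -φ})
    (r g K : ℕ) (hlen : ∀ l ∈ B, l.length = r) (hK : B.card ≤ K)
    (hg : ∀ l ∈ B, ∀ {a : ℕ} (cs : List (Fin (a + 1))),
      twoQubitGates (flipIf none (l.zip cs)) ≤ g) :
    MeasurableWith V (K * g) := by
  -- Ancilla 0 is the readout; the `r` others hold the eigenvalue records.
  let cs : List (Fin (r + 1)) := (List.finRange r).map Fin.succ
  have hcs : cs.Nodup := (List.nodup_finRange r).map (Fin.succ_injective r)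
  have h0 : 0 ∉ cs := by simp [cs, Fin.succ_ne_zero]
  refine ⟨r, B.toList.flatMap fun l => flipIf none (l.zip cs), ?_, fun ψ => ?_⟩
  · have : ∀ Ls : List (List (Pauli n)), (∀ l ∈ Ls, l ∈ B) →
        twoQubitGates (Ls.flatMap fun l => flipIf none (l.zip cs)) ≤ Ls.length * g := by
      intro Ls
      induction Ls with
      | nil => intro _; simp [twoQubitGates]
      | cons l Ls ih =>
        intro h
        have h1 := ih fun l hl => h l (List.mem_cons_of_mem _ hl)
        have h2 := hg l (h l List.mem_cons_self) cs
        rw [List.flatMap_cons, twoQubitGates_append, List.length_cons, add_mul, one_mul]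
        omega
    refine (this B.toList (by simp)).trans ?_
    rw [Finset.length_toList]
    exact Nat.mul_le_mul_right g hK
  · have h := run_flatMap_flipIf cs hcs h0 B.toList (by simpa [cs] using hlen)
      (by simpa using hB) ((B.nodup_toList).pairwise_of_forall_ne fun l hl l' hl' hne =>
        horth l' (by simpa using hl') l (by simpa using hl) hne.symm) 0 ψ (by simp)
    rw [withAncillas_zero, zero_add, zero_add, Finset.sum_map_toList] at h
    rw [h, starProjection_eq_sum_jointProj B hB horth V hV]

end

/-! ### Generators of finite 2-groups -/

theorem two_mul_card_le_of_lt {M : Type*} [Group M] {H Γ : Subgroup M} [Finite Γ] (h : H < Γ) :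
    2 * Nat.card H ≤ Nat.card Γ := by
  obtain ⟨k, hk⟩ := Subgroup.card_dvd_of_le h.le
  have hpos : 0 < Nat.card Γ := Nat.card_pos
  have hk1 : k ≠ 1 := by
    rintro rfl
    exact h.ne (Subgroup.eq_of_le_of_card_ge h.le (by rw [hk, mul_one]))
  have hk0 : k ≠ 0 := by rintro rfl; simp [hk] at hpos
  have : 2 ≤ k := by omega
  rw [hk, mul_comm]
  exact Nat.mul_le_mul_left _ this

/-- A group of order less than `2 ^ (k + 1)` is generated by `k` elements. -/
theorem exists_generators {M : Type*} [Group M] (Γ : Subgroup M) [Finite Γ] (k : ℕ)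
    (hk : Nat.card Γ < 2 ^ (k + 1)) :
    ∃ l : List M, l.length ≤ k ∧ Subgroup.closure {x | x ∈ l} = Γ := by
  -- Greedy choice: while the generated subgroup is proper, a further element at least doubles its
  -- order.
  have key : ∀ j : ℕ, ∃ l : List M, l.length ≤ j ∧ (Subgroup.closure {x | x ∈ l} = Γ ∨
      (Subgroup.closure {x | x ∈ l} < Γ ∧ 2 ^ j ≤ Nat.card (Subgroup.closure {x | x ∈ l}))) := by
    intro j
    induction j with
    | zero =>
      refine ⟨[], le_rfl, ?_⟩
      have h1 : Subgroup.closure {x : M | x ∈ []} = ⊥ := by simp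
      rw [h1]
      rcases eq_or_ne Γ ⊥ with h | h
      · exact Or.inl h.symm
      · exact Or.inr ⟨bot_lt_iff_ne_bot.mpr h, by simp⟩
    | succ j ih =>
      obtain ⟨l, hl, h | ⟨hlt, hc⟩⟩ := ih
      · exact ⟨l, hl.trans (Nat.le_succ j), Or.inl h⟩
      · obtain ⟨x, hxΓ, hx⟩ := SetLike.exists_of_lt hlt
        have hle : Subgroup.closure {y | y ∈ x :: l} ≤ Γ := by
          rw [Subgroup.closure_le]
          intro y hy
          rcases List.mem_cons.mp hy with rfl | hy
          · exact hxΓ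
          · exact hlt.le (Subgroup.subset_closure hy)
        have hlt' : Subgroup.closure {y | y ∈ l} < Subgroup.closure {y | y ∈ x :: l} := by
          refine lt_of_le_of_ne (Subgroup.closure_mono fun y hy => List.mem_cons_of_mem _ hy) ?_
          intro he
          exact hx (he ▸ Subgroup.subset_closure List.mem_cons_self)
        have : Finite (Subgroup.closure {y | y ∈ x :: l}) :=
          Finite.of_injective _ (Subgroup.inclusion_injective hle)
        have h2 := two_mul_card_le_of_lt hlt'
        refine ⟨x :: l, Nat.succ_le_succ hl, ?_⟩
        rcases hle.eq_or_lt with h | h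
        · exact Or.inl h
        · exact Or.inr ⟨h, by rw [pow_succ]; omega⟩
  obtain ⟨l, hl, h | ⟨hlt, hc⟩⟩ := key k
  · exact ⟨l, hl, h⟩
  · have := two_mul_card_le_of_lt hlt
    rw [pow_succ] at hk
    omega

/-! ### Measuring auxiliary codes -/

section
variable {n : ℕ}

theorem act_eq_of_mem_closure {X : Set (U n)} {φ : H n} (h : ∀ g ∈ X, act (g : Op n) φ = φ)
    {g : U n} (hg : g ∈ Subgroup.closure X) : act (g : Op n) φ = φ := by
  induction hg using Subgroup.closure_induction with
  | mem x hx => exact h x hx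
  | one => exact act_one φ
  | mul x y _ _ hx hy => rw [Submonoid.coe_mul, act_mul, hy, hx]
  | inv x _ hx =>
    conv_lhs => rw [← hx]
    rw [← act_mul, ← Submonoid.coe_mul, inv_mul_cancel]
    exact act_one φ

theorem mem_translate {G : Subgroup (U n)} {Q : Submodule ℂ (H n)} {g : U n} (hg : g ∈ G) {ψ : H n}
    (hψ : ψ ∈ Q) : act (g : Op n) ψ ∈ translate G Q :=
  Submodule.mem_iSup_of_mem g (Submodule.mem_iSup_of_mem hg (Submodule.mem_map_of_mem hψ))

open Classical in
/-- The Pauli operator `± P` whose eigenvalue on `W |s⟩` is `-1` if `P` stabilizes `|s⟩`. -/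
def twist (W P : Pauli n) : Pauli n := if Pauli.sgn W P = 1 then P.neg else P

theorem matrix_twist (W P : Pauli n) : (twist W P).matrix = -Pauli.sgn W P • P.matrix := by
  unfold twist
  split_ifs with h
  · rw [h, Pauli.matrix_neg, neg_one_smul]
  · rw [(Pauli.sgn_eq W P).resolve_left h, neg_neg, one_smul]

theorem weight_twist (W P : Pauli n) : (twist W P).weight = P.weight := by
  unfold twist
  split_ifs <;> rfl

/-- The circuits accept eigenvalue -1, so the sign of `twist` turns each word's syndrome into the
pattern of all -1. -/
theorem act_twist_iff (W P : Pauli n) (φ : H n) :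
    act (twist W P).matrix φ = -φ ↔ act P.matrix φ = Pauli.sgn W P • φ := by
  rw [matrix_twist, act_smul, neg_smul, neg_inj]
  have h := Pauli.sgn_mul_self W P
  constructor
  · intro h'; rw [← h', smul_smul, h, one_smul, h']
  · intro h'; rw [h', smul_smul, h, one_smul]

variable {S : Subgroup (U n)} {s : H n}

/-- A stabilizer `P` commuting with `G` takes the value `Pauli.sgn (W i) P` on every `g W_i s`.
Conversely, applying the adjoint of `W i` to a vector with this syndrome makes it fixed by all such
stabilizers, so `mem_span_of_fixed` puts it in the span of `G s`. -/
theorem translate_eq_span {K : ℕ} (hS : IsWordStabilizer S) (hs : ‖s‖ = 1)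
    (hfix : ∀ g ∈ S, act (g : Op n) s = s) (W : Fin K → Pauli n) (G : Subgroup (U n)) [Finite G]
    (hG : ∀ g ∈ G, ∃ P : Pauli n, (g : Op n) = P.matrix) (l : List (Pauli n))
    (hl : ∀ P ∈ l, ∃ h ∈ S, (∀ g ∈ G, g * h = h * g) ∧ (h : Op n) = P.matrix)
    (hgen : ∀ φ : H n, (∀ P ∈ l, act P.matrix φ = φ) →
      ∀ h ∈ S, (∀ g ∈ G, g * h = h * g) → act (h : Op n) φ = φ) :
    translate G (Submodule.span ℂ (Set.range fun i => act (W i).matrix s)) =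
      Submodule.span ℂ {φ | ∃ i, ∀ P ∈ l, act (twist (W i) P).matrix φ = -φ} := by
  apply le_antisymm
  · refine iSup₂_le fun g hg => ?_
    rw [Submodule.map_span, Submodule.span_le]
    rintro _ ⟨_, ⟨i, rfl⟩, rfl⟩
    refine Submodule.subset_span ⟨i, fun P hP => ?_⟩
    obtain ⟨h, hhS, hhG, hhP⟩ := hl P hP
    have hc : P.matrix * (g : Op n) = (g : Op n) * P.matrix := by
      rw [← hhP]; exact (congrArg Subtype.val (hhG g hg)).symm
    have hW : P.matrix * (W i).matrix = Pauli.sgn (W i) P • ((W i).matrix * P.matrix) := by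
      rw [Pauli.matrix_comm (W i) P, smul_smul, Pauli.sgn_mul_self, one_smul]
    have hPs : act P.matrix s = s := by rw [← hhP]; exact hfix h hhS
    rw [act_twist_iff, ← act_mul, hc, act_mul, ← act_mul _ (W i).matrix, hW, act_smul, act_mul,
      hPs, map_smul]
  · rw [Submodule.span_le]
    rintro φ ⟨i, hi⟩
    have hχ : ∀ P ∈ l, act P.matrix (act (W i).matrix.conjTranspose φ) =
        act (W i).matrix.conjTranspose φ := by
      intro P hP
      have h1 := (act_twist_iff _ _ _).mp (hi P hP)
      have h2 : P.matrix * (W i).matrix.conjTranspose =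
          Pauli.sgn (W i) P • ((W i).matrix.conjTranspose * P.matrix) := by
        have := Pauli.matrix_comm (W i) P
        calc P.matrix * (W i).matrix.conjTranspose
            = (W i).matrix.conjTranspose * ((W i).matrix * P.matrix) *
                (W i).matrix.conjTranspose := by
              rw [← mul_assoc, Pauli.conjTranspose_mul_self, one_mul]
          _ = _ := by
              rw [this, mul_smul_comm, smul_mul_assoc, ← mul_assoc, mul_assoc,
                Pauli.mul_conjTranspose_self, mul_one]
      rw [← act_mul, h2, act_smul, act_mul, h1, map_smul, smul_smul, Pauli.sgn_mul_self, one_smul]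
    have hmem := mem_span_of_fixed hS hs hfix G hG _ (hgen _ hχ)
    have hφ : φ = act (W i).matrix (act (W i).matrix.conjTranspose φ) := by
      rw [← act_mul, Pauli.mul_conjTranspose_self, act_one]
    rw [hφ]
    -- It remains to move `W i` past `g`, which costs only a sign as both are Pauli operators.
    refine (Submodule.span_le (p := (translate G _).comap (act (W i).matrix))).mpr ?_ hmem
    rintro _ ⟨g, hg, rfl⟩
    obtain ⟨P, hP⟩ := hG g hg
    rw [SetLike.mem_coe, Submodule.mem_comap, ← act_mul, hP, Pauli.matrix_comm, act_smul, act_mul,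
      ← hP]
    exact Submodule.smul_mem _ _ (mem_translate hg (Submodule.subset_span ⟨i, rfl⟩))

/-- Each word contributes one signed copy of `l`. Copies that differ contain some `P` with opposite
signs and are orthogonal; equal copies merge in the `Finset`, so at most `K` remain. Twisting keeps
weights, so `hc` bounds the cost through the weights alone. -/
theorem measurableWith_translate_of_generators {K : ℕ} (hS : IsWordStabilizer S) (hs : ‖s‖ = 1)
    (hfix : ∀ g ∈ S, act (g : Op n) s = s) (W : Fin K → Pauli n) (G : Subgroup (U n)) [Finite G]
    (hG : ∀ g ∈ G, ∃ P : Pauli n, (g : Op n) = P.matrix) (l : List (Pauli n))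
    (hl : ∀ P ∈ l, ∃ h ∈ S, (∀ g ∈ G, g * h = h * g) ∧ (h : Op n) = P.matrix)
    (hgen : ∀ φ : H n, (∀ P ∈ l, act P.matrix φ = φ) →
      ∀ h ∈ S, (∀ g ∈ G, g * h = h * g) → act (h : Op n) φ = φ) (c : ℕ)
    (hc : ∀ l' : List (Pauli n), List.Forall₂ (fun P R => P.weight = R.weight) l' l →
      ∀ {a : ℕ} (cs : List (Fin (a + 1))), twoQubitGates (flipIf none (l'.zip cs)) ≤ c) :
    MeasurableWith (translate G (Submodule.span ℂ (Set.range fun i => act (W i).matrix s)))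
      (K * c) := by
  classical
  let f : Fin K → List (Pauli n) := fun i => l.map (twist (W i))
  have hmem : ∀ P ∈ l, ∀ R ∈ l, P.matrix * R.matrix = R.matrix * P.matrix := by
    intro P hP R hR
    obtain ⟨h, hhS, -, hhP⟩ := hl P hP
    obtain ⟨h', hhS', -, hhP'⟩ := hl R hR
    rw [← hhP, ← hhP']; exact congrArg Subtype.val (hS.comm h hhS h' hhS')
  have hsq : ∀ P ∈ l, P.matrix * P.matrix = 1 := by
    intro P hP
    obtain ⟨h, hhS, -, hhP⟩ := hl P hP
    rw [← hhP]; exact congrArg Subtype.val (hS.mul_self hhS)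
  have hinv : ∀ i, IsInvolutive (f i) := by
    intro i
    constructor
    · intro P' hP'
      obtain ⟨P, hP, rfl⟩ := List.mem_map.mp hP'
      rw [matrix_twist, smul_mul_smul_comm, hsq P hP, neg_mul_neg, Pauli.sgn_mul_self, one_smul]
    · intro P' hP' R' hR'
      obtain ⟨P, hP, rfl⟩ := List.mem_map.mp hP'
      obtain ⟨R, hR, rfl⟩ := List.mem_map.mp hR'
      rw [matrix_twist, matrix_twist, smul_mul_smul_comm, smul_mul_smul_comm, hmem P hP R hR,
        mul_comm (-Pauli.sgn _ P)]
  refine measurableWith_of_jointProj (Finset.univ.image f) ?_ ?_ _ ?_ l.length c K ?_ ?_ ?_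
  · intro l' hl'
    obtain ⟨i, -, rfl⟩ := Finset.mem_image.mp hl'
    exact hinv i
  · intro l₁ hl₁ l₂ hl₂ hne φ
    obtain ⟨i, -, rfl⟩ := Finset.mem_image.mp hl₁
    obtain ⟨j, -, rfl⟩ := Finset.mem_image.mp hl₂
    obtain ⟨P, hP, hPne⟩ : ∃ P ∈ l, twist (W i) P ≠ twist (W j) P := by
      by_contra! h
      exact hne (List.map_congr_left h)
    refine jointProj_jointProj_eq_zero (hinv i) (hinv j) _ _ (List.mem_map_of_mem hP)
      (List.mem_map_of_mem hP) ?_ φ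
    unfold twist at hPne ⊢
    split_ifs at hPne ⊢ <;> simp_all [Pauli.matrix_neg]
  · rw [translate_eq_span hS hs hfix W G hG l hl hgen]
    congr 1
    ext φ
    simp [f]
  · intro l' hl'
    obtain ⟨i, -, rfl⟩ := Finset.mem_image.mp hl'
    simp [f]
  · exact Finset.card_image_le.trans (by simp)
  · intro l' hl' a cs
    obtain ⟨i, -, rfl⟩ := Finset.mem_image.mp hl'
    refine hc _ ?_ cs
    rw [List.forall₂_map_left_iff]
    exact List.forall₂_same.mpr fun P _ => weight_twist _ P

/-- The first operator has no control, so its Hadamard gates are one-qubit gates and it costs only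
twice its weight. -/
theorem twoQubitGates_flipIf_cons (w v r : ℕ) {a : ℕ} (P : Pauli n) (l : List (Pauli n))
    (hP : P.weight ≤ v) (hl : ∀ R ∈ l, R.weight ≤ w) (hr : l.length ≤ r)
    (cs : List (Fin (a + 1))) :
    twoQubitGates (flipIf none ((P :: l).zip cs)) ≤ 2 * v + 2 * r * (w + 2) + 1 := by
  cases cs with
  | nil => simp [flipIf, twoQubitGates, ancillaGate, Gate.isTwo]
  | cons c cs =>
    have h := twoQubitGates_flipIf_some w c (l.zip cs) fun x hx => hl _ (List.of_mem_zip hx).1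
    have hlen : (l.zip cs).length ≤ r := by
      rw [List.length_zip]; exact (min_le_left _ _).trans hr
    have h' : 2 * (l.zip cs).length * (w + 2) ≤ 2 * r * (w + 2) := by gcongr
    rw [List.zip_cons_cons, flipIf, twoQubitGates_append, twoQubitGates_append,
      twoQubitGates_stage_none]
    omega

theorem Pauli.weight_le (P : Pauli n) : P.weight ≤ n := by
  simpa [weight] using Finset.card_le_univ P.support

theorem Pauli.weight_le_of_letter_eq_I (P : Pauli n) (i : Fin n) (h : P.letter i = Letter.I) :
    P.weight ≤ n - 1 := by
  have : P.support ⊆ Finset.univ.erase i := by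
    intro j hj
    rw [Finset.mem_erase]
    refine ⟨?_, Finset.mem_univ j⟩
    rintro rfl
    exact Pauli.mem_support.mp hj h
  simpa [weight] using Finset.card_le_card this

/-- Choose `b` anticommuting with `a`: the two generate the one-qubit matrices, so only the identity
letter commutes with both. -/
theorem Letter.exists_anticomm (a : Letter) (ha : a ≠ I) : ∃ b, b ≠ I ∧ ∀ c, sgn c a = 1 →
    sgn c b = 1 → c = I := by
  cases a
  · exact absurd rfl ha
  · refine ⟨Z, by simp, fun c => ?_⟩; cases c <;> norm_num [sgn] <;> decide
  · refine ⟨Z, by simp, fun c => ?_⟩; cases c <;> norm_num [sgn] <;> decide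
  · refine ⟨X, by simp, fun c => ?_⟩; cases c <;> norm_num [sgn] <;> decide

theorem Pauli.comm_iff_sgn (P R : Pauli n) :
    P.matrix * R.matrix = R.matrix * P.matrix ↔ sgn P R = 1 := by
  rw [Pauli.matrix_comm P R]
  constructor
  · intro h
    refine (sgn_eq P R).resolve_right fun h' => ?_
    rw [h', neg_one_smul, Pauli.matrix_mul] at h
    have h0 : (2 : ℂ) • (R.mul P).matrix = 0 := by
      rw [two_smul]; nth_rw 1 [← h]; exact neg_add_cancel _
    exact Pauli.matrix_ne_zero _ ((smul_eq_zero_iff_right two_ne_zero).mp h0)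
  · intro h; rw [h, one_smul]

/-- Generators of a proper subgroup of a maximal stabilizer group. -/
theorem exists_pauli_generators (hn : 1 ≤ n) (hS : IsWordStabilizer S) (S₀ : Subgroup (U n))
    (h₀ : S₀ < S) : ∃ l : List (Pauli n), l.length ≤ n - 1 ∧
      (∀ P ∈ l, ∃ h ∈ S₀, (h : Op n) = P.matrix) ∧
      ∀ φ : H n, (∀ P ∈ l, act P.matrix φ = φ) → ∀ h ∈ S₀, act (h : Op n) φ = φ := by
  have := hS.finite
  have : Finite S₀ := Finite.of_injective _ (Subgroup.inclusion_injective h₀.le)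
  have hc := two_mul_card_le_of_lt h₀
  have hpos : 0 < Nat.card S₀ := Nat.card_pos
  rw [hS.card] at hc
  -- A proper subgroup has order at most `2 ^ (n - 1)`, which is below `2 ^ n`.
  obtain ⟨l, hl, hlS⟩ := exists_generators S₀ (n - 1) (by
    rw [Nat.sub_add_cancel hn]; omega)
  have hl₀ : ∀ g ∈ l, g ∈ S₀ := fun g hg => hlS ▸ Subgroup.subset_closure hg
  have hf : ∀ g : U n, ∃ P : Pauli n, g ∈ S → (g : Op n) = P.matrix := by
    intro g
    by_cases hg : g ∈ S
    · obtain ⟨P, hP⟩ := hS.pauli g hg; exact ⟨P, fun _ => hP⟩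
    · exact ⟨Pauli.one n, fun h => absurd h hg⟩
  choose f hf using hf
  refine ⟨l.map f, by simpa using hl, ?_, ?_⟩
  · intro P hP
    obtain ⟨g, hg, rfl⟩ := List.mem_map.mp hP
    exact ⟨g, hl₀ g hg, hf g (h₀.le (hl₀ g hg))⟩
  · intro φ hφ h hh
    rw [← hlS] at hh
    refine act_eq_of_mem_closure (fun g hg => ?_) hh
    rw [hf g (h₀.le (hl₀ g hg))]
    exact hφ _ (List.mem_map_of_mem hg)

/-- The auxiliary code of a group of Pauli operators containing one of weight one can be measured
with few two-qubit gates. -/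
theorem measurableWith_translate {K : ℕ} (hn : 2 ≤ n) (hS : IsWordStabilizer S) (hs : ‖s‖ = 1)
    (hfix : ∀ g ∈ S, act (g : Op n) s = s) (W : Fin K → Pauli n) (G : Subgroup (U n)) [Finite G]
    (hG : ∀ g ∈ G, ∃ P : Pauli n, (g : Op n) = P.matrix) (p : Pauli n) (i : Fin n)
    (hp : p.support = {i}) (hpG : ∃ g ∈ G, (g : Op n) = p.matrix) :
    MeasurableWith (translate G (Submodule.span ℂ (Set.range fun i => act (W i).matrix s)))
      (2 * K * (n - 1) * (n + 3)) := by
  obtain ⟨k, rfl⟩ : ∃ k, n = k + 2 := ⟨n - 2, by omega⟩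
  have hcost : 2 * K * (k + 2 - 1) * (k + 2 + 3) = K * (2 * (k + 1) * (k + 5)) := by
    rw [show k + 2 - 1 = k + 1 from rfl]; ring
  rw [hcost]
  set S₀ : Subgroup (U (k + 2)) := S ⊓ Subgroup.centralizer (G : Set (U (k + 2))) with hS₀
  have hmem₀ : ∀ h, h ∈ S₀ ↔ h ∈ S ∧ ∀ g ∈ G, g * h = h * g := by
    intro h; rw [hS₀, Subgroup.mem_inf, Subgroup.mem_centralizer_iff]; rfl
  have hle : S₀ ≤ S := inf_le_left
  -- If some stabilizer fails to commute with `G`, then `n - 1` generators of weight at most `n` fit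
  -- the bound. If all commute, `n` generators are needed and their weights have to be reduced.
  rcases hle.lt_or_eq with hlt | heq
  · obtain ⟨l, hlen, hl, hgen⟩ := exists_pauli_generators (by omega) hS S₀ hlt
    refine measurableWith_translate_of_generators hS hs hfix W G hG l ?_ ?_ _ ?_
    · intro P hP
      obtain ⟨h, hh, hhP⟩ := hl P hP
      exact ⟨h, ((hmem₀ h).mp hh).1, ((hmem₀ h).mp hh).2, hhP⟩
    · exact fun φ hφ h hh hhG => hgen φ hφ h ((hmem₀ h).mpr ⟨hh, hhG⟩)
    · intro l' hl' a cs
      have hlen' := hl'.length_eq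
      cases l' with
      | nil => simp [flipIf, twoQubitGates, ancillaGate, Gate.isTwo]
      | cons P l' =>
        rw [List.length_cons] at hlen'
        refine (twoQubitGates_flipIf_cons (k + 2) (k + 2) k P l' P.weight_le
          (fun R _ => R.weight_le) (by omega) cs).trans ?_
        nlinarith
  · have hcommG : ∀ h ∈ S, ∀ g ∈ G, g * h = h * g := fun h hh => ((hmem₀ h).mp (heq ▸ hh)).2
    obtain ⟨g, hg, hgp⟩ := hpG
    -- The weight-one operator `p` commutes with all of `S`, so `S` contains an element `R` with the
    -- same letters.
    obtain ⟨R, hRp, r, hr, hrR⟩ := exists_mem_stabilizer_of_comm hS hs hfix p fun h hh => by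
      rw [← hgp]; exact congrArg Subtype.val (hcommG h hh g hg)
    have hRsupp : R.support = {i} := by rw [← hp]; ext j; simp [Pauli.mem_support, hRp]
    have hRi : R.letter i ≠ Letter.I := Pauli.mem_support.mp (by rw [hRsupp]; simp)
    obtain ⟨b, hb, hbI⟩ := Letter.exists_anticomm _ hRi
    set q : Pauli (k + 2) := Pauli.single i b with hq
    have hqi : q.letter i = b := by simp [hq, Pauli.single]
    have hqsgn : ∀ P : Pauli (k + 2), Pauli.sgn P q = Letter.sgn (P.letter i) b := fun P => by
      rw [P.sgn_single q i (Pauli.support_single i b), hqi]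
    have hRsgn : ∀ P : Pauli (k + 2), Pauli.sgn P R = Letter.sgn (P.letter i) (R.letter i) :=
      fun P => P.sgn_single R i hRsupp.subset
    have hRq : Pauli.sgn R q ≠ 1 := by
      intro h
      rw [hqsgn] at h
      exact hRi (hbI _ (by simp [Letter.sgn]) h)
    -- Elements of `S₁` commute with both `R` and `q`, which forces the identity letter on qubit
    -- `i`; together with `R` they generate `S`.
    set S₁ : Subgroup (U (k + 2)) := S ⊓ Subgroup.centralizer {q.toU} with hS₁
    have hmem₁ : ∀ h, h ∈ S₁ ↔ h ∈ S ∧ q.toU * h = h * q.toU := by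
      intro h; rw [hS₁, Subgroup.mem_inf, Subgroup.mem_centralizer_iff]; simp
    have hsgn₁ : ∀ h ∈ S, ∀ P : Pauli (k + 2), (h : Op (k + 2)) = P.matrix →
        (h ∈ S₁ ↔ Pauli.sgn P q = 1) := by
      intro h hh P hP
      rw [hmem₁, ← Pauli.comm_iff_sgn, ← hP]
      constructor
      · rintro ⟨-, h'⟩; exact (congrArg Subtype.val h').symm
      · intro h'; exact ⟨hh, Subtype.ext h'.symm⟩
    have hlt : S₁ < S := by
      refine lt_of_le_of_ne inf_le_left fun h => hRq ?_
      exact (hsgn₁ r hr R hrR).mp (h ▸ hr)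
    obtain ⟨l, hlen, hl, hgen⟩ := exists_pauli_generators (by omega) hS S₁ hlt
    refine measurableWith_translate_of_generators hS hs hfix W G hG (R :: l) ?_ ?_ _ ?_
    · intro P hP
      rcases List.mem_cons.mp hP with rfl | hP
      · exact ⟨r, hr, hcommG r hr, hrR⟩
      · obtain ⟨h, hh, hhP⟩ := hl P hP
        exact ⟨h, hlt.le hh, hcommG h (hlt.le hh), hhP⟩
    · intro φ hφ h hh _
      have hfixR : act (r : Op (k + 2)) φ = φ := by rw [hrR]; exact hφ R List.mem_cons_self
      have hgen' := hgen φ fun P hP => hφ P (List.mem_cons_of_mem _ hP)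
      by_cases h₁ : h ∈ S₁
      · exact hgen' h h₁
      · obtain ⟨P, hP⟩ := hS.pauli h hh
        have hPq := (Pauli.sgn_eq P q).resolve_left (mt (hsgn₁ h hh P hP).mpr h₁)
        have hRq' := (Pauli.sgn_eq R q).resolve_left hRq
        -- Both `r` and `h` anticommute with `q`, so the signs cancel in the product.
        have hmem : r * h ∈ S₁ := by
          rw [hmem₁]
          refine ⟨mul_mem hr hh, Subtype.ext ?_⟩
          have h1 : R.matrix * q.matrix = -(q.matrix * R.matrix) := by
            rw [Pauli.matrix_comm, hRq', neg_one_smul]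
          have h2 : P.matrix * q.matrix = -(q.matrix * P.matrix) := by
            rw [Pauli.matrix_comm, hPq, neg_one_smul]
          simp only [Submonoid.coe_mul, Pauli.coe_toU, hrR, hP]
          rw [mul_assoc, h2, mul_neg, ← mul_assoc R.matrix, h1, neg_mul, neg_neg, mul_assoc]
        have h3 := hgen' _ hmem
        rw [Submonoid.coe_mul, act_mul] at h3
        have h4 : act (r : Op (k + 2)) (act (r : Op (k + 2)) (act (h : Op (k + 2)) φ)) =
            act (h : Op (k + 2)) φ := by
          rw [← act_mul, ← Submonoid.coe_mul, hS.mul_self hr]; exact act_one _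
        rw [← h4, h3, hfixR]
    · intro l' hl' a cs
      cases hl' with
      | cons hPR hl' =>
        rename_i P l'
        have hw : ∀ P' ∈ l, P'.weight ≤ k + 1 := by
          intro P' hP'
          obtain ⟨h, hh, hhP⟩ := hl P' hP'
          refine P'.weight_le_of_letter_eq_I i (hbI _ ?_ ?_)
          · rw [← hRsgn, ← Pauli.comm_iff_sgn, ← hrR, ← hhP]
            exact congrArg Subtype.val (hS.comm h (hlt.le hh) r hr)
          · rw [← hqsgn]; exact (hsgn₁ h (hlt.le hh) P' hhP).mp hh
        have hw' : ∀ P' ∈ l', P'.weight ≤ k + 1 := by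
          intro P' hP'
          obtain ⟨j, hj, rfl⟩ := List.mem_iff_getElem.mp hP'
          have hj' : j < l.length := hl'.length_eq ▸ hj
          have := (List.forall₂_iff_get.mp hl').2 j hj hj'
          simp only [List.get_eq_getElem] at this
          rw [this]
          exact hw _ (List.getElem_mem hj')
        have hP1 : P.weight ≤ 1 := by rw [hPR, Pauli.weight, hRsupp]; simp
        -- With `n = k + 2`, the cost is one operator of weight 1 and at most `n - 1` of weight at
        -- most `n - 1`.
        refine (twoQubitGates_flipIf_cons (k + 1) 1 (k + 1) P l' hP1 hw'
          (hl'.length_eq.le.trans hlen) cs).trans ?_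
        nlinarith

end

/-! ### Separating families of subgroups of index two -/

section
variable {M : Type*} [Group M]

/-- Any element outside of `T` is outside of some subgroup of index two containing `T`, if `Γ / T`
is an elementary abelian 2-group. -/
theorem exists_index_two_subgroup (Γ T : Subgroup M) (hT : T ≤ Γ) (hsq : ∀ g ∈ Γ, g * g ∈ T)
    (hcomm : ∀ g ∈ Γ, ∀ h ∈ Γ, g * h * g⁻¹ * h⁻¹ ∈ T) (x : M) (hx : x ∈ Γ) (hxT : x ∉ T) :
    ∃ G : Subgroup M, T ≤ G ∧ G ≤ Γ ∧ x ∉ G ∧ ∀ a ∈ Γ, ∀ b ∈ Γ, a ∉ G → b ∉ G → a * b ∈ G := by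
  -- `G` is maximal among the subgroups of `Γ` that contain `T` and avoid `x`.
  obtain ⟨G, hTG, ⟨hGΓ, hxG⟩, hmax⟩ := zorn_le_nonempty₀ {G : Subgroup M | G ≤ Γ ∧ x ∉ G}
    (fun c hc hchain G hG => ⟨sSup c, ⟨sSup_le fun H hH => (hc hH).1, fun h => by
      obtain ⟨H, hH, hxH⟩ := (Subgroup.mem_sSup_of_directedOn ⟨G, hG⟩ hchain.directedOn).mp h
      exact (hc hH).2 hxH⟩, fun H hH => le_sSup hH⟩) T ⟨hT, hxT⟩
  refine ⟨G, hTG, hGΓ, hxG, ?_⟩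
  have hconj : ∀ a ∈ Γ, ∀ h ∈ G, a⁻¹ * h * a ∈ G := by
    intro a ha h hh
    have h1 := mul_mem (hTG (hcomm a⁻¹ (inv_mem ha) h (hGΓ hh))) hh
    simpa [mul_assoc] using h1
  have key : ∀ a ∈ Γ, a ∉ G → x * a ∈ G := by
    intro a ha haG
    have haa : a * a ∈ G := hTG (hsq a ha)
    -- This is the union of `G` and `G a⁻¹`, a subgroup because `Γ` normalizes `G` and `a * a ∈ G`.
    -- It contains `a`, so by maximality it contains `x`.
    let G' : Subgroup M :=
      { carrier := {g | g ∈ G ∨ g * a ∈ G}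
        one_mem' := Or.inl (one_mem _)
        mul_mem' := by
          rintro g h (hg | hg) (hh | hh)
          · exact Or.inl (mul_mem hg hh)
          · exact Or.inr (by rw [mul_assoc]; exact mul_mem hg hh)
          · exact Or.inr (by
              have := mul_mem hg (hconj a ha h hh)
              simpa [mul_assoc] using this)
          · exact Or.inl (by
              have := mul_mem hg (mul_mem (hconj a ha _ hh) (inv_mem haa))
              simpa [mul_assoc] using this)
        inv_mem' := by
          rintro g (hg | hg)
          · exact Or.inl (inv_mem hg)
          · exact Or.inr (by
              have := mul_mem haa (hconj a ha _ (inv_mem hg))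
              simpa [mul_assoc] using this) }
    have hG' : G ≤ G' := fun g hg => Or.inl hg
    have hG'Γ : G' ≤ Γ := by
      rintro g (hg | hg)
      · exact hGΓ hg
      · exact (mul_mem_cancel_right ha).mp (hGΓ hg)
    by_contra hxa
    have hxG' : x ∉ G' := by rintro (h | h); exacts [hxG h, hxa h]
    exact haG (hmax ⟨hG'Γ, hxG'⟩ hG' (Or.inr haa))
  intro a ha b hb haG hbG
  have h1 := hconj x hx _ (key a ha haG)
  -- Here `a * b` is written as `(a * x) * (x * x)⁻¹ * (x * b)`.
  have h2 := mul_mem (mul_mem h1 (inv_mem (hTG (hsq x hx)))) (key b hb hbG)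
  simpa [mul_assoc] using h2

/-- If `Γ / T` is an elementary abelian 2-group of order at most `2 ^ m`, some `m` subgroups of
index two have intersection `T`. -/
theorem exists_separating_subgroups (Γ T : Subgroup M) (hT : T ≤ Γ) (hsq : ∀ g ∈ Γ, g * g ∈ T)
    (hcomm : ∀ g ∈ Γ, ∀ h ∈ Γ, g * h * g⁻¹ * h⁻¹ ∈ T) (m : ℕ) (h0 : T.relIndex Γ ≠ 0)
    (hm : T.relIndex Γ ≤ 2 ^ m) :
    ∃ l : List (Subgroup M), l.length ≤ m ∧
      (∀ G ∈ l, T ≤ G ∧ G ≤ Γ ∧ ∀ a ∈ Γ, ∀ b ∈ Γ, a ∉ G → b ∉ G → a * b ∈ G) ∧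
      ∀ g ∈ Γ, (∀ G ∈ l, g ∈ G) → g ∈ T := by
  -- The induction runs over the intersection `I` of the subgroups chosen so far; each new one omits
  -- an element of `I`, so the index of `T` at least halves.
  suffices H : ∀ I : Subgroup M, T ≤ I → I ≤ Γ → T.relIndex I ≠ 0 → T.relIndex I ≤ 2 ^ m →
      ∃ l : List (Subgroup M), l.length ≤ m ∧
      (∀ G ∈ l, T ≤ G ∧ G ≤ Γ ∧ ∀ a ∈ Γ, ∀ b ∈ Γ, a ∉ G → b ∉ G → a * b ∈ G) ∧
      ∀ g ∈ I, (∀ G ∈ l, g ∈ G) → g ∈ T from H Γ hT le_rfl h0 hm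
  clear h0 hm
  induction m with
  | zero =>
    intro I hTI _ h0 h1
    have : T.relIndex I = 1 := by rw [pow_zero] at h1; omega
    exact ⟨[], le_rfl, by simp, fun g hg _ => Subgroup.relIndex_eq_one.mp this hg⟩
  | succ m ih =>
    intro I hTI hIΓ h0 h1
    by_cases hI : I ≤ T
    · exact ⟨[], Nat.zero_le _, by simp, fun g hg _ => hI hg⟩
    · obtain ⟨x, hxI, hxT⟩ := SetLike.not_le_iff_exists.mp hI
      obtain ⟨G, hTG, hGΓ, hxG, hG⟩ :=
        exists_index_two_subgroup Γ T hT hsq hcomm x (hIΓ hxI) hxT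
      have hmul := Subgroup.relIndex_mul_relIndex T (I ⊓ G) I (le_inf hTI hTG) inf_le_left
      have hne0 : T.relIndex (I ⊓ G) ≠ 0 := left_ne_zero_of_mul (hmul ▸ h0)
      have hne0' : (I ⊓ G).relIndex I ≠ 0 := right_ne_zero_of_mul (hmul ▸ h0)
      have hne1 : (I ⊓ G).relIndex I ≠ 1 := fun h =>
        hxG (Subgroup.relIndex_eq_one.mp h hxI).2
      have h2 : 2 ≤ (I ⊓ G).relIndex I := by omega
      have hle : T.relIndex (I ⊓ G) ≤ 2 ^ m := by
        have := Nat.mul_le_mul_left (T.relIndex (I ⊓ G)) h2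
        rw [pow_succ] at h1
        omega
      obtain ⟨l, hl, hlG, hlT⟩ := ih (I ⊓ G) (le_inf hTI hTG) (inf_le_left.trans hIΓ) hne0 hle
      refine ⟨G :: l, Nat.succ_le_succ hl, ?_, ?_⟩
      · intro G' hG'
        rcases List.mem_cons.mp hG' with rfl | hG'
        · exact ⟨hTG, hGΓ, hG⟩
        · exact hlG G' hG'
      · intro g hg h
        exact hlT g ⟨hg, h G List.mem_cons_self⟩ fun G' hG' => h G' (List.mem_cons_of_mem _ hG')

end

/-! ### Degenerate and orthogonal errors -/

section
variable {n : ℕ}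

/-- A detectable Pauli operator acts trivially on a CWS code or takes it to an orthogonal space. -/
theorem actsTrivially_or_orthogonal {K : ℕ} {Q : Submodule ℂ (H n)} (hQ : IsCWSCode K Q)
    (P : Pauli n) (hP : Detectable Q P.matrix) :
    ActsTrivially Q P.matrix ∨ ∀ ψ ∈ Q, ∀ φ ∈ Q, (inner ℂ ψ (act P.matrix φ) : ℂ) = 0 := by
  refine hP.symm.imp_right fun hout => ?_
  obtain ⟨s, W, ⟨hs, S, hS, hfix⟩, -, rfl, -⟩ := hQ
  have hmem : ∀ i, act (W i).matrix s ∈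
      Submodule.span ℂ (Set.range fun i => act (W i).matrix s) := fun i =>
    Submodule.subset_span ⟨i, rfl⟩
  have hword : ∀ i j,
      (inner ℂ (act (W i).matrix s) (act P.matrix (act (W j).matrix s)) : ℂ) = 0 := by
    intro i j
    -- The adjoint of `W i` times `P` times `W j` is again a Pauli operator. If it acted on `s` as a
    -- scalar, `P` would take word `j` to a multiple of word `i`, inside the code.
    have h := pauli_act_stabilizerState hS hs hfix ((W i).adj.mul (P.mul (W j)))
    rw [← Pauli.matrix_mul, ← Pauli.matrix_mul, Pauli.matrix_adj, act_mul, act_mul] at h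
    rcases h with ⟨c, hc⟩ | h
    · exfalso
      refine hout _ (hmem j) (fun h0 => ?_) ?_
      · have : s = 0 := by
          rw [← act_one s, ← (W j).conjTranspose_mul_self, act_mul, h0, map_zero]
        simp [this] at hs
      · have h1 : act P.matrix (act (W j).matrix s) = c • act (W i).matrix s := by
          rw [← map_smul, ← hc, ← act_mul _ (W i).matrix.conjTranspose,
            Pauli.mul_conjTranspose_self, act_one]
        rw [h1]
        exact Submodule.smul_mem _ _ (hmem i)
    · rw [inner_act_left]; exact h
  intro ψ hψ φ hφ
  induction hψ using Submodule.span_induction with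
  | zero => simp
  | add x y _ _ hx hy => rw [inner_add_left, hx, hy, add_zero]
  | smul c x _ hx => rw [inner_smul_left, hx, mul_zero]
  | mem ψ hψ =>
    obtain ⟨i, rfl⟩ := hψ
    induction hφ using Submodule.span_induction with
    | zero => simp
    | add x y _ _ hx hy => rw [map_add, inner_add_right, hx, hy, add_zero]
    | smul c x _ hx => rw [map_smul, inner_smul_right, hx, mul_zero]
    | mem φ hφ =>
      obtain ⟨j, rfl⟩ := hφ
      exact hword i j

theorem degenerate_or_orthogonal {K t : ℕ} {Q : Submodule ℂ (H n)} (hQ : IsCWSCode K Q)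
    (hcorr : IsErrorCorrecting t Q) (E₁ E₂ : Pauli n) (h₁ : E₁.weight ≤ t) (h₂ : E₂.weight ≤ t) :
    ActsTrivially Q (E₁.matrix.conjTranspose * E₂.matrix) ∨
      ∀ ψ ∈ Q, ∀ φ ∈ Q, (inner ℂ (act E₁.matrix ψ) (act E₂.matrix φ) : ℂ) = 0 := by
  have h := hcorr E₁ E₂ h₁ h₂
  rw [← Pauli.matrix_adj, Pauli.matrix_mul] at h ⊢
  refine (actsTrivially_or_orthogonal hQ _ h).imp_right fun h ψ hψ φ hφ => ?_
  rw [inner_act_left, ← act_mul, ← Pauli.matrix_adj, Pauli.matrix_mul]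
  exact h ψ hψ φ hφ

theorem act_eq_smul_of_degenerate {Q : Submodule ℂ (H n)} {E : Op n} {R : Pauli n}
    (h : ActsTrivially Q (R.matrix.conjTranspose * E)) :
    ∃ c : ℂ, ∀ ψ ∈ Q, act E ψ = c • act R.matrix ψ := by
  obtain ⟨c, hc⟩ := h
  refine ⟨c, fun ψ hψ => ?_⟩
  rw [← map_smul, ← hc ψ hψ, ← act_mul, ← mul_assoc, Pauli.mul_conjTranspose_self, one_mul]

theorem ActsTrivially.smul {Q : Submodule ℂ (H n)} {E : Op n} (h : ActsTrivially Q E) (d : ℂ) :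
    ActsTrivially Q (d • E) := by
  obtain ⟨c, hc⟩ := h
  exact ⟨d * c, fun ψ hψ => by rw [act_smul, hc ψ hψ, smul_smul]⟩

theorem actsTrivially_one (Q : Submodule ℂ (H n)) : ActsTrivially Q (1 : Op n) :=
  ⟨1, fun ψ _ => by simp⟩

/-- The elements of a group acting trivially on a code. -/
def trivialSubgroup (Γ : Subgroup (U n)) (Q : Submodule ℂ (H n)) : Subgroup (U n) where
  carrier := {g | g ∈ Γ ∧ ActsTrivially Q (g : Op n)}
  one_mem' := ⟨one_mem _, actsTrivially_one Q⟩
  mul_mem' := by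
    rintro g h ⟨hg, c, hc⟩ ⟨hh, d, hd⟩
    refine ⟨mul_mem hg hh, c * d, fun ψ hψ => ?_⟩
    rw [Submonoid.coe_mul, act_mul, hd ψ hψ, map_smul, hc ψ hψ, smul_smul, mul_comm]
  inv_mem' := by
    rintro g ⟨hg, c, hc⟩
    have hinv : ∀ ψ, act ((g⁻¹ : U n) : Op n) (act (g : Op n) ψ) = ψ := fun ψ => by
      rw [← act_mul, ← Submonoid.coe_mul, inv_mul_cancel]; exact act_one ψ
    refine ⟨inv_mem hg, c⁻¹, fun ψ hψ => ?_⟩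
    have h := hinv ψ
    rw [hc ψ hψ, map_smul] at h
    by_cases h0 : c = 0
    · rw [h0, zero_smul] at h
      rw [← h, map_zero, smul_zero]
    · nth_rw 2 [← h]
      rw [smul_smul, inv_mul_cancel₀ h0, one_smul]

theorem trivialSubgroup_le (Γ : Subgroup (U n)) (Q : Submodule ℂ (H n)) :
    trivialSubgroup Γ Q ≤ Γ := fun _ h => h.1

theorem finite_of_pauli (G : Subgroup (U n)) (hG : ∀ g ∈ G, ∃ P : Pauli n, (g : Op n) = P.matrix) :
    Finite G := by
  have := Pauli.finite (n := n)
  choose f hf using fun g : G => hG g g.2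
  exact Finite.of_injective f fun g h hgh => by
    refine Subtype.ext (Subtype.ext ?_)
    rw [hf g, hf h, hgh]

theorem inv_mul_mem_trivialSubgroup {Γ : Subgroup (U n)} (Q : Submodule ℂ (H n)) {g h : U n}
    (hg : g ∈ Γ) (hh : h ∈ Γ) {c : ℂ} (hc : (g : Op n) = c • (h : Op n)) :
    h⁻¹ * g ∈ trivialSubgroup Γ Q := by
  refine ⟨mul_mem (inv_mem hh) hg, ?_⟩
  rw [Submonoid.coe_mul, hc, mul_smul_comm, ← Submonoid.coe_mul, inv_mul_cancel]
  exact (actsTrivially_one Q).smul c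

/-- A coset is determined by the letters on `A`, as proportional elements differ by a scalar. Four
letters per qubit give `4 ^ A.card`, the source of the `2 * t` tests. -/
theorem relIndex_trivialSubgroup (A : Finset (Fin n)) (Q : Submodule ℂ (H n)) :
    (trivialSubgroup (errorGroup A) Q).relIndex (errorGroup A) ≠ 0 ∧
      (trivialSubgroup (errorGroup A) Q).relIndex (errorGroup A) ≤ 2 ^ (2 * A.card) := by
  choose f hf hfm using fun g : errorGroup A => exists_pauli_of_mem_errorGroup g.2
  set T := (trivialSubgroup (errorGroup A) Q).subgroupOf (errorGroup A) with hT
  let F : (errorGroup A ⧸ T) → (A → Fin 4) := fun x j => ((f x.out).letter j).code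
  have hF : Function.Injective F := by
    intro x y hxy
    have hletter : (f x.out).letter = (f y.out).letter := by
      ext j
      by_cases hj : j ∈ A
      · exact Letter.code_injective (congrFun hxy ⟨j, hj⟩)
      · have h : ∀ g, (f g).letter j = Letter.I := fun g => by
          by_contra h; exact hj (hf g (Pauli.mem_support.mpr h))
        rw [h, h]
    obtain ⟨c, hc⟩ := Pauli.matrix_of_letter_eq _ _ hletter
    rw [← hfm, ← hfm] at hc
    have := inv_mul_mem_trivialSubgroup Q x.out.2 y.out.2 hc
    rw [← Quotient.out_eq' x, ← Quotient.out_eq' y]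
    symm
    exact QuotientGroup.eq.mpr this
  have hfin : Finite (errorGroup A ⧸ T) := Finite.of_injective F hF
  have hcard := Nat.card_le_card_of_injective F hF
  constructor
  · exact Nat.card_pos.ne'
  · refine hcard.trans ?_
    simp [pow_mul]

/-- If neither `X` nor `Z` on qubit `i` lies in `G`, their product does, and it has weight one too.
-/
theorem exists_weight_one {A : Finset (Fin n)} {i : Fin n} (hi : i ∈ A) (G : Subgroup (U n))
    (hG : ∀ a ∈ errorGroup A, ∀ b ∈ errorGroup A, a ∉ G → b ∉ G → a * b ∈ G) :
    ∃ p : Pauli n, p.support = {i} ∧ ∃ g ∈ G, (g : Op n) = p.matrix := by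
  have hX : (Pauli.single i Letter.X).toU ∈ errorGroup A :=
    Subgroup.subset_closure ⟨i, hi, Or.inl rfl⟩
  have hZ : (Pauli.single i Letter.Z).toU ∈ errorGroup A :=
    Subgroup.subset_closure ⟨i, hi, Or.inr rfl⟩
  by_cases h1 : (Pauli.single i Letter.X).toU ∈ G
  · refine ⟨_, ?_, _, h1, rfl⟩
    ext j; simp [Pauli.mem_support, Pauli.single]
  by_cases h2 : (Pauli.single i Letter.Z).toU ∈ G
  · refine ⟨_, ?_, _, h2, rfl⟩
    ext j; simp [Pauli.mem_support, Pauli.single]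
  refine ⟨(Pauli.single i Letter.X).mul (Pauli.single i Letter.Z), ?_, _, hG _ hX _ hZ h1 h2, ?_⟩
  · ext j; by_cases h : j = i <;> simp [Pauli.mem_support, Pauli.single, Pauli.mul, Letter.mul, h]
  · rw [← Pauli.matrix_mul]; rfl

/-- The Pauli operator `R` is in the group `G` up to a phase. -/
def InUpToPhase (R : Pauli n) (G : Subgroup (U n)) : Prop :=
  ∃ g ∈ G, ∃ c : ℂ, R.matrix = c • (g : Op n)

/-- Subgroup tests that identify the errors on a cluster up to degeneracy. -/
theorem exists_subgroup_tests (A : Finset (Fin n)) (Q : Submodule ℂ (H n)) :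
    ∃ l : List (Subgroup (U n)), l.length ≤ 2 * A.card ∧
      (∀ G ∈ l, trivialSubgroup (errorGroup A) Q ≤ G ∧ G ≤ errorGroup A ∧
        ∀ a ∈ errorGroup A, ∀ b ∈ errorGroup A, a ∉ G → b ∉ G → a * b ∈ G) ∧
      ∀ R E : Pauli n, R.support ⊆ A → E.support ⊆ A →
        (∀ G ∈ l, InUpToPhase R G ↔ InUpToPhase E G) →
        ActsTrivially Q (R.matrix.conjTranspose * E.matrix) := by
  obtain ⟨h0, hm⟩ := relIndex_trivialSubgroup A Q
  have hneg : ∀ g ∈ errorGroup A, ∀ c : ℂ, (g : Op n) = c • 1 →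
      g ∈ trivialSubgroup (errorGroup A) Q := fun g hg c hc =>
    ⟨hg, by rw [hc]; exact (actsTrivially_one Q).smul c⟩
  obtain ⟨l, hl, hlG, hsep⟩ := exists_separating_subgroups (errorGroup A)
    (trivialSubgroup (errorGroup A) Q) (trivialSubgroup_le _ _)
    (by
      intro g hg
      obtain ⟨P, -, hP⟩ := exists_pauli_of_mem_errorGroup hg
      rcases P.matrix_mul_self with h | h
      · exact hneg _ (mul_mem hg hg) 1 (by rw [Submonoid.coe_mul, hP, h, one_smul])
      · exact hneg _ (mul_mem hg hg) (-1) (by rw [Submonoid.coe_mul, hP, h, neg_one_smul]))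
    (by
      intro g hg h hh
      obtain ⟨P, -, hP⟩ := exists_pauli_of_mem_errorGroup hg
      obtain ⟨R, -, hR⟩ := exists_pauli_of_mem_errorGroup hh
      have h1 : (g * h * g⁻¹ * h⁻¹ : U n) = (g * h) * (h * g)⁻¹ := by group
      have h2 : ((g * h : U n) : Op n) = Pauli.sgn P R • ((h * g : U n) : Op n) := by
        rw [Submonoid.coe_mul, Submonoid.coe_mul, hP, hR, Pauli.matrix_comm]
      rw [h1]
      refine hneg _ (mul_mem (mul_mem hg hh) (inv_mem (mul_mem hh hg))) (Pauli.sgn P R) ?_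
      rw [Submonoid.coe_mul, h2, smul_mul_assoc, ← Submonoid.coe_mul, mul_inv_cancel]
      rfl)
    (2 * A.card) h0 hm
  refine ⟨l, hl, hlG, fun R E hR hE hiff => ?_⟩
  obtain ⟨r, hr, c, hc⟩ := exists_mem_errorGroup A R hR
  obtain ⟨e, he, d, hd⟩ := exists_mem_errorGroup A E hE
  -- Every `G` in the list contains the scalars of the error group, so membership up to phase agrees
  -- with membership of any representative.
  have hmem : ∀ (P : Pauli n) (g : U n) (c : ℂ), g ∈ errorGroup A → P.matrix = c • (g : Op n) →
      ∀ G ∈ l, InUpToPhase P G ↔ g ∈ G := by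
    intro P g c hg hc G hG
    constructor
    · rintro ⟨g', hg', c', hc'⟩
      have hc0 : c ≠ 0 := by
        rintro rfl
        exact P.matrix_ne_zero (by rw [hc, zero_smul])
      have : (g : Op n) = (c⁻¹ * c') • (g' : Op n) := by
        rw [mul_smul, ← hc', hc, smul_smul, inv_mul_cancel₀ hc0, one_smul]
      have h := (hlG G hG).1
        (inv_mul_mem_trivialSubgroup Q hg ((hlG G hG).2.1 hg') this)
      simpa using mul_mem hg' h
    · exact fun h => ⟨g, h, c, hc⟩
  -- For each `G`, `r` and `e` are both inside or both outside; in either case index two puts `r⁻¹ *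
  -- e` in `G`.
  have hre : r⁻¹ * e ∈ trivialSubgroup (errorGroup A) Q := by
    refine hsep _ (mul_mem (inv_mem hr) he) fun G hG => ?_
    have h := hiff G hG
    rw [hmem R r c hr hc G hG, hmem E e d he hd G hG] at h
    by_cases hrG : r ∈ G
    · exact mul_mem (inv_mem hrG) (h.mp hrG)
    · exact (hlG G hG).2.2 _ (inv_mem hr) _ he (fun h' => hrG (by simpa using inv_mem h'))
        (fun h' => hrG (h.mpr h'))
  have : R.matrix.conjTranspose * E.matrix = (star c * d) • ((r⁻¹ * e : U n) : Op n) := by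
    rw [hc, hd, Matrix.conjTranspose_smul, smul_mul_smul_comm]; rfl
  rw [this]
  exact hre.2.smul _

theorem mem_orthogonal_translate {G : Subgroup (U n)} {Q : Submodule ℂ (H n)} {φ : H n}
    (h : ∀ g ∈ G, ∀ ψ ∈ Q, (inner ℂ (act (g : Op n) ψ) φ : ℂ) = 0) : φ ∈ (translate G Q)ᗮ := by
  have hle : translate G Q ≤ (Submodule.span ℂ {φ})ᗮ := by
    refine iSup₂_le fun g hg => ?_
    rintro _ ⟨ψ, hψ, rfl⟩
    rw [Submodule.mem_orthogonal_singleton_iff_inner_left]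
    exact h g hg ψ hψ
  rw [Submodule.mem_orthogonal]
  exact fun u hu => Submodule.mem_orthogonal_singleton_iff_inner_left.mp (hle hu)

theorem mem_translate_of_inUpToPhase {G : Subgroup (U n)} {Q : Submodule ℂ (H n)} {E : Pauli n}
    (h : InUpToPhase E G) {ψ : H n} (hψ : ψ ∈ Q) : act E.matrix ψ ∈ translate G Q := by
  obtain ⟨g, hg, c, hc⟩ := h
  rw [hc, act_smul]
  exact Submodule.smul_mem _ _ (mem_translate hg hψ)

end

/-! ### Protocols -/

namespace Protocol

variable {n : ℕ}

/-- For the error `E`, each sequence of outcomes never occurs, or leaves the corrupted state intact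
and declares an error of weight at most `t` that is degenerate with `E`. -/
def Handles (Q : Submodule ℂ (H n)) (t : ℕ) (E : Pauli n) (p : Protocol n) : Prop :=
  ∀ b ∈ p.branches,
    (∀ ψ ∈ Q, b.1 (act E.matrix ψ) = 0) ∨
    ((∀ ψ ∈ Q, b.1 (act E.matrix ψ) = act E.matrix ψ) ∧ b.2.weight ≤ t ∧
      ActsTrivially Q (b.2.matrix.conjTranspose * E.matrix))

variable {Q : Submodule ℂ (H n)} {t : ℕ}

theorem Identifies.corrects {p : Protocol n} (h : p.Identifies Q t) : p.Corrects Q t := by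
  intro E hE b hb
  rcases h E hE b hb with h0 | ⟨h1, -, c, hc⟩
  · exact ⟨0, fun ψ hψ => by rw [h0 ψ hψ, map_zero, zero_smul]⟩
  · exact ⟨c, fun ψ hψ => by rw [h1 ψ hψ, ← act_mul, hc ψ hψ]⟩

/-- The corrupted code lies entirely in `V` or entirely in its complement, so one outcome never
occurs and the other leaves the state alone. -/
theorem handles_measure {V : Submodule ℂ (H n)} {yes no : Protocol n} {E : Pauli n}
    (h : ((∀ ψ ∈ Q, act E.matrix ψ ∈ V) ∧ yes.Handles Q t E) ∨
      ((∀ ψ ∈ Q, act E.matrix ψ ∈ Vᗮ) ∧ no.Handles Q t E)) :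
    (measure V yes no).Handles Q t E := by
  intro b hb
  rw [branches, List.mem_append, List.mem_map, List.mem_map] at hb
  rcases h with ⟨hV, hyes⟩ | ⟨hV, hno⟩
  · have hp : ∀ ψ ∈ Q, V.starProjection (act E.matrix ψ) = act E.matrix ψ := fun ψ hψ =>
      Submodule.starProjection_eq_self_iff.mpr (hV ψ hψ)
    rcases hb with ⟨b, hb, rfl⟩ | ⟨b, hb, rfl⟩
    · refine (hyes b hb).imp (fun h ψ hψ => ?_) fun ⟨h, h'⟩ => ⟨fun ψ hψ => ?_, h'⟩
      · simp [hp ψ hψ, h ψ hψ]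
      · simp [hp ψ hψ, h ψ hψ]
    · exact Or.inl fun ψ hψ => by simp [hp ψ hψ]
  · have hp : ∀ ψ ∈ Q, V.starProjection (act E.matrix ψ) = 0 := fun ψ hψ =>
      Submodule.eq_starProjection_of_mem_orthogonal (zero_mem _) (by simpa using hV ψ hψ)
    rcases hb with ⟨b, hb, rfl⟩ | ⟨b, hb, rfl⟩
    · exact Or.inl fun ψ hψ => by simp [hp ψ hψ]
    · refine (hno b hb).imp (fun h ψ hψ => ?_) fun ⟨h, h'⟩ => ⟨fun ψ hψ => ?_, h'⟩
      · simp [hp ψ hψ, h ψ hψ]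
      · simp [hp ψ hψ, h ψ hψ]

/-- Degenerate errors produce the same states up to a common scalar, so no sequence of measurements
distinguishes them. -/
theorem Handles.of_degenerate {p : Protocol n} {E E' : Pauli n} (h : p.Handles Q t E')
    (hE : ActsTrivially Q (E'.matrix.conjTranspose * E.matrix)) : p.Handles Q t E := by
  obtain ⟨c, hc⟩ := act_eq_smul_of_degenerate hE
  intro b hb
  refine (h b hb).imp (fun h ψ hψ => ?_) fun ⟨h, hw, d, hd⟩ =>
    ⟨fun ψ hψ => ?_, hw, c * d, fun ψ hψ => ?_⟩
  · rw [hc ψ hψ, map_smul, h ψ hψ, smul_zero]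
  · rw [hc ψ hψ, map_smul, h ψ hψ]
  · rw [act_mul, hc ψ hψ, map_smul, ← act_mul, hd ψ hψ, smul_smul]

open Classical in
/-- The subgroup tests in a list are made one after the other; then some error that is among the
candidates `C` and consistent with the outcomes is declared. -/
def subgroupTests (Q : Submodule ℂ (H n)) : List (Subgroup (U n)) → Set (Pauli n) → Protocol n
  -- Without a consistent candidate the identity is declared; its empty support keeps the
  -- declaration inside any cluster.
  | [], C => recover (if h : C.Nonempty then h.some else Pauli.one n)
  | G :: l, C => measure (translate G Q) (subgroupTests Q l {R | R ∈ C ∧ InUpToPhase R G})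
      (subgroupTests Q l {R | R ∈ C ∧ ¬InUpToPhase R G})

theorem depth_subgroupTests (l : List (Subgroup (U n))) (C : Set (Pauli n)) :
    (subgroupTests Q l C).depth = l.length := by
  induction l generalizing C with
  | nil => rfl
  | cons G l ih => simp [subgroupTests, depth, ih]

theorem isSubgroupTesting_subgroupTests (A : Finset (Fin n)) (l : List (Subgroup (U n)))
    (C : Set (Pauli n)) (hl : ∀ G ∈ l, G ≤ errorGroup A) (hC : ∀ R ∈ C, R.support ⊆ A) :
    (subgroupTests Q l C).IsSubgroupTesting Q A := by
  induction l generalizing C with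
  | nil =>
    unfold subgroupTests IsSubgroupTesting
    split_ifs with h
    · exact hC _ h.some_mem
    · simp
  | cons G l ih =>
    have hl' : ∀ G ∈ l, G ≤ errorGroup A := fun G hG => hl G (List.mem_cons_of_mem _ hG)
    exact ⟨⟨G, hl G List.mem_cons_self, rfl⟩, ih _ hl' fun R hR => hC R hR.1,
      ih _ hl' fun R hR => hC R hR.1⟩

theorem allMeasurements_subgroupTests (f : Submodule ℂ (H n) → Prop) (l : List (Subgroup (U n)))
    (C : Set (Pauli n)) (hl : ∀ G ∈ l, f (translate G Q)) :
    (subgroupTests Q l C).AllMeasurements f := by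
  induction l generalizing C with
  | nil => trivial
  | cons G l ih =>
    have hl' : ∀ G ∈ l, f (translate G Q) := fun G hG => hl G (List.mem_cons_of_mem _ hG)
    exact ⟨hl G List.mem_cons_self, ih _ hl', ih _ hl'⟩

/-- Along the outcomes that occur, `E` stays among the candidates, so the error declared at the end
agrees with `E` on every test. -/
theorem handles_subgroupTests (E : Pauli n) (l : List (Subgroup (U n))) (C : Set (Pauli n))
    (hE : E ∈ C) (hC : ∀ R ∈ C, R.weight ≤ t)
    (hno : ∀ G ∈ l, ¬InUpToPhase E G → ∀ ψ ∈ Q, act E.matrix ψ ∈ (translate G Q)ᗮ)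
    (hsep : ∀ R ∈ C, (∀ G ∈ l, InUpToPhase R G ↔ InUpToPhase E G) →
      ActsTrivially Q (R.matrix.conjTranspose * E.matrix)) :
    (subgroupTests Q l C).Handles Q t E := by
  induction l generalizing C with
  | nil =>
    have hne : C.Nonempty := ⟨E, hE⟩
    intro b hb
    rw [subgroupTests, dif_pos hne, branches, List.mem_singleton] at hb
    subst hb
    exact Or.inr ⟨fun _ _ => rfl, hC _ hne.some_mem, hsep _ hne.some_mem (by simp)⟩
  | cons G l ih =>
    have hno' : ∀ G ∈ l, ¬InUpToPhase E G → ∀ ψ ∈ Q, act E.matrix ψ ∈ (translate G Q)ᗮ :=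
      fun G hG => hno G (List.mem_cons_of_mem _ hG)
    refine handles_measure ?_
    by_cases hG : InUpToPhase E G
    · refine Or.inl ⟨fun ψ hψ => mem_translate_of_inUpToPhase hG hψ,
        ih _ ⟨hE, hG⟩ (fun R hR => hC R hR.1) hno' fun R hR h => hsep R hR.1 ?_⟩
      intro G' hG'
      rcases List.mem_cons.mp hG' with rfl | hG'
      · exact iff_of_true hR.2 hG
      · exact h G' hG'
    · refine Or.inr ⟨hno G List.mem_cons_self hG,
        ih _ ⟨hE, hG⟩ (fun R hR => hC R hR.1) hno' fun R hR h => hsep R hR.1 ?_⟩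
      intro G' hG'
      rcases List.mem_cons.mp hG' with rfl | hG'
      · exact iff_of_false hR.2 hG
      · exact h G' hG'

/-- Clustered measurements with a given procedure for each cluster. -/
def clustered (Q : Submodule ℂ (H n)) (f : Finset (Fin n) → Protocol n) :
    List (Finset (Fin n)) → Protocol n
  | [] => recover (Pauli.one n)
  | [A] => f A
  | A :: B :: L => measure (translate (errorGroup A) Q) (f A) (clustered Q f (B :: L))

/-- The last cluster needs no measurement of its own, which accounts for the `- 1`. -/
theorem depth_clustered (f : Finset (Fin n) → Protocol n) (m : ℕ) (L : List (Finset (Fin n)))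
    (hf : ∀ A ∈ L, (f A).depth ≤ m) (hL : L ≠ []) :
    (clustered Q f L).depth ≤ L.length + m - 1 := by
  match L with
  | [] => exact absurd rfl hL
  | [A] =>
    have := hf A List.mem_cons_self
    simpa [clustered] using this
  | A :: B :: L =>
    have h1 := depth_clustered f m (B :: L) (fun A hA => hf A (List.mem_cons_of_mem _ hA)) (by simp)
    have h2 := hf A List.mem_cons_self
    simp only [clustered, depth, List.length_cons] at h1 ⊢
    omega

theorem isClustered_clustered (f : Finset (Fin n) → Protocol n) (m : ℕ)
    (L : List (Finset (Fin n))) (hf : ∀ A ∈ L, (f A).depth ≤ m ∧ (f A).IsSubgroupTesting Q A)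
    (hL : L ≠ []) : (clustered Q f L).IsClustered Q m L := by
  match L with
  | [] => exact absurd rfl hL
  | [A] => exact (hf A List.mem_cons_self).symm
  | A :: B :: L =>
    have h := hf A List.mem_cons_self
    exact ⟨_, _, rfl, h.2, h.1,
      isClustered_clustered f m (B :: L) (fun A hA => hf A (List.mem_cons_of_mem _ hA)) (by simp)⟩

theorem allMeasurements_clustered (P : Submodule ℂ (H n) → Prop) (f : Finset (Fin n) → Protocol n)
    (L : List (Finset (Fin n))) (hf : ∀ A ∈ L, (f A).AllMeasurements P)
    (hP : 2 ≤ L.length → ∀ A ∈ L, P (translate (errorGroup A) Q)) :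
    (clustered Q f L).AllMeasurements P := by
  match L with
  | [] => trivial
  | [A] => exact hf A List.mem_cons_self
  | A :: B :: L =>
    have hP' := hP (by simp)
    exact ⟨hP' A List.mem_cons_self, hf A List.mem_cons_self,
      allMeasurements_clustered P f (B :: L) (fun A hA => hf A (List.mem_cons_of_mem _ hA))
        fun _ A hA => hP' A (List.mem_cons_of_mem _ hA)⟩

/-- A positive outcome for `A` only shows that `E` is degenerate with some error on `A`, whose
treatment then serves for `E`. A negative one rules out that `E` itself is supported on `A`, so a
later cluster contains its support. -/
theorem handles_clustered (f : Finset (Fin n) → Protocol n) (E : Pauli n)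
    (L : List (Finset (Fin n)))
    (hf : ∀ A ∈ L, ∀ E' : Pauli n, E'.support ⊆ A → (f A).Handles Q t E')
    (horth : ∀ A ∈ L, (∃ E' : Pauli n, E'.support ⊆ A ∧
        ActsTrivially Q (E'.matrix.conjTranspose * E.matrix)) ∨
      ∀ ψ ∈ Q, act E.matrix ψ ∈ (translate (errorGroup A) Q)ᗮ)
    (hL : ∃ A ∈ L, E.support ⊆ A) : (clustered Q f L).Handles Q t E := by
  match L with
  | [] => simp at hL
  | [A] =>
    obtain ⟨A', hA', hE⟩ := hL
    obtain rfl := List.mem_singleton.mp hA'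
    exact hf A' hA' E hE
  | A :: B :: L =>
    refine handles_measure ?_
    by_cases h : ∃ E' : Pauli n, E'.support ⊆ A ∧
        ActsTrivially Q (E'.matrix.conjTranspose * E.matrix)
    · obtain ⟨E', hE'A, hE'⟩ := h
      refine Or.inl ⟨fun ψ hψ => ?_, (hf A List.mem_cons_self E' hE'A).of_degenerate hE'⟩
      obtain ⟨c, hc⟩ := act_eq_smul_of_degenerate hE'
      rw [hc ψ hψ]
      exact Submodule.smul_mem _ _
        (mem_translate_of_inUpToPhase (exists_mem_errorGroup A E' hE'A) hψ)
    · refine Or.inr ⟨(horth A List.mem_cons_self).resolve_left h,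
        handles_clustered f E (B :: L) (fun A hA => hf A (List.mem_cons_of_mem _ hA))
          (fun A hA => horth A (List.mem_cons_of_mem _ hA)) ?_⟩
      obtain ⟨A', hA', hE⟩ := hL
      rcases List.mem_cons.mp hA' with rfl | hA'
      · exact absurd ⟨E, hE, by rw [Pauli.conjTranspose_mul_self]; exact actsTrivially_one Q⟩ h
      · exact ⟨A', hA', hE⟩

end Protocol

theorem measurableWith_translate_errorGroup {n K : ℕ} (hn : 2 ≤ n) {Q : Submodule ℂ (H n)}
    (hQ : IsCWSCode K Q) {A : Finset (Fin n)} (hA : A.Nonempty) (G : Subgroup (U n))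
    (hGA : G ≤ errorGroup A)
    (hG : ∀ a ∈ errorGroup A, ∀ b ∈ errorGroup A, a ∉ G → b ∉ G → a * b ∈ G) :
    MeasurableWith (translate G Q) (2 * K * (n - 1) * (n + 3)) := by
  obtain ⟨s, W, ⟨hs, S, hS, hfix⟩, -, rfl, -⟩ := hQ
  obtain ⟨i, hi⟩ := hA
  obtain ⟨p, hp, hpG⟩ := exists_weight_one hi G hG
  have hGP : ∀ g ∈ G, ∃ P : Pauli n, (g : Op n) = P.matrix := fun g hg =>
    (exists_pauli_of_mem_errorGroup (hGA hg)).imp fun _ h => h.2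
  have := finite_of_pauli G hGP
  exact measurableWith_translate hn hS hs hfix W G hGP p i hp hpG

end

end CWS

theorem theorem2 (n K t : ℕ) (ht : t ≤ n) (hn : t = 0 ∨ 2 ≤ n)
    (Q : Submodule ℂ (CWS.H n)) (hQ : CWS.IsCWSCode K Q) (hcorr : CWS.IsErrorCorrecting t Q) :
    ∃ p : CWS.Protocol n,
      p.Corrects Q t ∧
      p.Identifies Q t ∧
      p.depth ≤ n.choose t + 2 * t - 1 ∧
      p.AllMeasurements (fun V => CWS.MeasurableWith V (2 * K * (n - 1) * (n + 3))) ∧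
      ∃ L : List (Finset (Fin n)), L.Nodup ∧ (∀ A, A ∈ L ↔ A.card = t) ∧
        p.IsClustered Q (2 * t) L := by
  open CWS CWS.Protocol in
  choose l hl hlG hsep using fun A => exists_subgroup_tests A Q
  let f : Finset (Fin n) → Protocol n := fun A => subgroupTests Q (l A) {R | R.support ⊆ A}
  let L : List (Finset (Fin n)) := (Finset.powersetCard t Finset.univ).toList
  have hL : ∀ A, A ∈ L ↔ A.card = t := by simp [L, Finset.mem_powersetCard]
  have hLlen : L.length = n.choose t := by simp [L]
  have hLne : L ≠ [] := by
    rw [← List.length_pos_iff, hLlen]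
    exact Nat.choose_pos ht
  have hlen : ∀ A ∈ L, (l A).length ≤ 2 * t := fun A hA => (hL A).mp hA ▸ hl A
  have hdepth : ∀ A ∈ L, (f A).depth ≤ 2 * t := fun A hA => by
    rw [depth_subgroupTests]; exact hlen A hA
  have hweight : ∀ A ∈ L, ∀ R : Pauli n, R.support ⊆ A → R.weight ≤ t := fun A hA R hR =>
    (Finset.card_le_card hR).trans ((hL A).mp hA).le
  -- An error degenerate with no element of `G` is orthogonal to each image of the code under `G`,
  -- by the dichotomy; this needs only `E.weight ≤ t`, not support on `A`.
  have horth : ∀ A ∈ L, ∀ G ≤ errorGroup A, ∀ E : Pauli n, E.weight ≤ t →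
      (∀ g ∈ G, ∀ P : Pauli n, P.support ⊆ A → (g : Op n) = P.matrix →
        ¬ActsTrivially Q (P.matrix.conjTranspose * E.matrix)) →
      ∀ ψ ∈ Q, act E.matrix ψ ∈ (translate G Q)ᗮ := by
    intro A hA G hGA E hE h ψ hψ
    refine mem_orthogonal_translate fun g hg φ hφ => ?_
    obtain ⟨P, hPA, hP⟩ := exists_pauli_of_mem_errorGroup (hGA hg)
    rw [hP]
    exact (degenerate_or_orthogonal hQ hcorr P E (hweight A hA P hPA) hE).resolve_left
      (h g hg P hPA hP) φ hφ ψ hψ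
  have hf : ∀ A ∈ L, ∀ E : Pauli n, E.support ⊆ A → (f A).Handles Q t E := by
    intro A hA E hE
    refine handles_subgroupTests E (l A) _ hE (hweight A hA) (fun G hG hEG => ?_)
      fun R hR h => hsep A R E hR hE h
    refine horth A hA G (hlG A G hG).2.1 E (hweight A hA E hE) fun g hg P _ hP htriv => hEG ?_
    obtain ⟨e, he, c, hc⟩ := exists_mem_errorGroup A E hE
    have hc0 : c ≠ 0 := by
      rintro rfl
      exact E.matrix_ne_zero (by rw [hc, zero_smul])
    -- If `g` in `G` were degenerate with `E`, then `g⁻¹ * e` would act trivially. Since `G`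
    -- contains all such elements of the error group, `E` would lie in `G` up to phase.
    have hge : g⁻¹ * e ∈ G := by
      refine (hlG A G hG).1 ⟨mul_mem (inv_mem ((hlG A G hG).2.1 hg)) he, ?_⟩
      have : ((g⁻¹ * e : U n) : Op n) = c⁻¹ • (P.matrix.conjTranspose * E.matrix) := by
        rw [hc, mul_smul_comm, smul_smul, inv_mul_cancel₀ hc0, one_smul, ← hP]; rfl
      rw [this]
      exact htriv.smul _
    exact ⟨e, by simpa using mul_mem hg hge, c, hc⟩
  have hident : (clustered Q f L).Identifies Q t := by
    intro E hE
    refine handles_clustered f E L hf (fun A hA => ?_) ?_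
    · refine or_iff_not_imp_left.mpr fun h => horth A hA _ le_rfl E hE fun g _ P hPA _ htriv => ?_
      exact h ⟨P, hPA, htriv⟩
    -- As `t ≤ n`, the support of `E` extends to a set of exactly `t` qubits.
    · obtain ⟨A, hEA, -, hA⟩ := Finset.exists_subsuperset_card_eq (Finset.subset_univ E.support) hE
        (by simpa using ht)
      exact ⟨A, (hL A).mpr hA, hEA⟩
  refine ⟨clustered Q f L, hident.corrects, hident, ?_, ?_, L, Finset.nodup_toList _, hL, ?_⟩
  · rw [← hLlen]
    exact depth_clustered f (2 * t) L hdepth hLne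
  -- For `t = 0` there is one cluster and no test, so nothing is measured and no bound on `n` is
  -- needed.
  · rcases Nat.eq_zero_or_pos t with rfl | htpos
    · refine allMeasurements_clustered _ f L (fun A hA => ?_) fun h => ?_
      · refine allMeasurements_subgroupTests _ _ _ fun G hG => ?_
        have := hlen A hA
        have hnil : l A = [] := List.eq_nil_of_length_eq_zero (by omega)
        simp [hnil] at hG
      · rw [hLlen, Nat.choose_zero_right] at h
        omega
    · have hmeas : ∀ A ∈ L, ∀ G ≤ errorGroup A,
          (∀ a ∈ errorGroup A, ∀ b ∈ errorGroup A, a ∉ G → b ∉ G → a * b ∈ G) →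
          MeasurableWith (translate G Q) (2 * K * (n - 1) * (n + 3)) := by
        intro A hA G hGA hG
        have hAne : A.Nonempty := by
          rw [← Finset.card_pos, (hL A).mp hA]; exact htpos
        exact measurableWith_translate_errorGroup (hn.resolve_left (by omega)) hQ hAne G hGA hG
      refine allMeasurements_clustered _ f L (fun A hA => ?_) fun _ A hA => ?_
      · exact allMeasurements_subgroupTests _ _ _ fun G hG =>
          hmeas A hA G (hlG A G hG).2.1 (hlG A G hG).2.2
      -- For the full error group the index-two condition is vacuous.
      · exact hmeas A hA _ le_rfl fun a ha _ _ h => absurd ha h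
  · exact isClustered_clustered f (2 * t) L
      (fun A hA => ⟨hdepth A hA, isSubgroupTesting_subgroupTests A _ _
        (fun G hG => (hlG A G hG).2.1) fun R hR => hR⟩) hLne
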